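/- Let $Q=(Q_0,Q_1)$ be a finite quiver without oriented cycles. A (complete) filtration on a finite-dimensional complex vector space $V$ is a chain of subspaces $0=F(0)\subseteq F(1)\subseteq\cdots\subseteq F(\ell)=V$ with $\dim F(i+1)\le\dim F(i)+1$ for all $i$; we set $F(i)=V$ for $i\ge\ell$. For a subspace $S\subseteq V$ we use the inherited filtrations $F_S(i)=F(i)\cap S$ on $S$ and $F_{V/S}(i)=(F(i)+S)/S$ on $V/S$. A filtered dimension vector $(\mathcal V,\mathcal F)$ is a family $\mathcal V=(V_x)_{x\in Q_0}$ of finite-dimensional complex vector spaces with a family $\mathcal F=(F_x)_{x\in Q_0}$ of filtrations, $F_x$ on $V_x$. For families $\mathcal V,\mathcal W$ put $\mathcal H_Q(\mathcal V,\mathcal W)=\bigoplus_{a:x\to y\in Q_1}\mathrm{Hom}(V_x,W_y)$ and $\mathcal H_Q(\mathcal V)=\mathcal H_Q(\mathcal V,\mathcal V)$. For filtered dimension vectors $(\mathcal V,\mathcal F)$, $(\mathcal W,\mathcal G)$ let $\mathfrak g_{Q,\mathcal F,\mathcal G}(\mathcal V,\mathcal W)$ be the space of families $\Phi=(\Phi_x)_{x\in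 Q_0}$ of linear maps $\Phi_x:V_x\to W_x$ with $\Phi_x(F_x(i))\subseteq G_x(i)$ for all $x$ and $i$, and let $$\mathrm{eul}_{Q,\mathcal F,\mathcal G}(\mathcal V,\mathcal W)=\dim\mathfrak g_{Q,\mathcal F,\mathcal G}(\mathcal V,\mathcal W)-\dim\mathcal H_Q(\mathcal V,\mathcal W).$$ For $v\in\mathcal H_Q(\mathcal V)$ and $w\in\mathcal H_Q(\mathcal W)$ let $\mathrm{Ext}_{Q,\mathcal F,\mathcal G}(v,w)$ be the cokernel of the linear map $\mathfrak g_{Q,\mathcal F,\mathcal G}(\mathcal V,\mathcal W)\to\mathcal H_Q(\mathcal V,\mathcal W)$, $\Phi\mapsto(\Phi_yv_a-w_a\Phi_x)_{a:x\to y}$, and let $$\mathrm{ext}_{Q,\mathcal F,\mathcal G}(\mathcal V,\mathcal W)=\min_{v,w}\dim\mathrm{Ext}_{Q,\mathcal F,\mathcal G}(v,w).$$ For a family $\mathcal S=(S_x)_{x\in Q_0}$ of subspaces $S_x\subseteq V_x$, let $\Omega(\mathcal S,\mathcal F)$ be the closure, in $\prod_x\mathrm{Gr}(\dim S_x,V_x)$,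 of the orbit of $\mathcal S$ under the group of all $(g_x)\in\prod_x\mathrm{GL}(V_x)$ with $g_xF_x(i)=F_x(i)$ for all $x$ and $i$. Write $\mathcal S\subseteq_Q\mathcal V$ if for every $v\in\mathcal H_Q(\mathcal V)$ there is $\mathcal N\in\Omega(\mathcal S,\mathcal F)$ with $v_aN_x\subseteq N_y$ for every arrow $a:x\to y$. **Theorem.** Let $(\mathcal V,\mathcal F)$ and $(\mathcal W,\mathcal G)$ be filtered dimension vectors. 1. If $\mathrm{ext}_{Q,\mathcal F,\mathcal G}(\mathcal V,\mathcal W)=0$, then $\mathrm{eul}_{Q,\mathcal F_{\mathcal S},\mathcal G}(\mathcal S,\mathcal W)\ge 0$ for every $\mathcal S\subseteq_Q\mathcal V$. 2. Conversely, if $\mathrm{eul}_{Q,\mathcal F_{\mathcal S},\mathcal G}(\mathcal S,\mathcal W)\ge 0$ for every $\mathcal S\subseteq_Q\mathcal V$ such that $\mathrm{eul}_{Q,\mathcal F_{\mathcal S},\mathcal F_{\mathcal V/\mathcal S}}(\mathcal S,\mathcal V/\mathcal S)=0$, then $\mathrm{ext}_{Q,\mathcal F,\mathcal G}(\mathcal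 V,\mathcal W)=0$. -/

import Mathlib

namespace FilteredQuiver

universe u₀ u₁ u₂ u₃

noncomputable section

/-- A quiver has no (oriented) cycles: every path from a vertex to itself is trivial. -/
def IsAcyclic (Q₀ : Type u₀) [Quiver.{u₁} Q₀] : Prop :=
  ∀ (x : Q₀) (p : Quiver.Path x x), p.length = 0

/-! ### Filtrations -/

/-- A (complete) filtration `0 = F 0 ⊆ F 1 ⊆ ⋯ ⊆ F ℓ = V` whose dimensions increase by at most
one in each step. It is indexed by all of `ℕ`, with `F i = V` for `i ≥ ℓ`, so that filtrations
with different `ℓ` can be compared. -/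
structure Filtration (V : Type u₂) [AddCommGroup V] [Module ℂ V] where
  toFun : ℕ → Submodule ℂ V
  zero_eq_bot : toFun 0 = ⊥
  monotone : Monotone toFun
  exists_eq_top : ∃ ℓ : ℕ, toFun ℓ = ⊤
  finrank_succ_le : ∀ i : ℕ,
    Module.finrank ℂ (toFun (i + 1)) ≤ Module.finrank ℂ (toFun i) + 1

instance {V : Type u₂} [AddCommGroup V] [Module ℂ V] :
    CoeFun (Filtration V) (fun _ => ℕ → Submodule ℂ V) := ⟨Filtration.toFun⟩

theorem finrank_comap_subtype_eq {V : Type u₂} [AddCommGroup V] [Module ℂ V]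
    (S A : Submodule ℂ V) :
    Module.finrank ℂ (A.comap S.subtype) = Module.finrank ℂ (A ⊓ S : Submodule ℂ V) := by
  rw [← Submodule.finrank_map_subtype_eq S (A.comap S.subtype), Submodule.map_comap_subtype,
    inf_comm]

theorem finrank_inf_add_le {V : Type u₂} [AddCommGroup V] [Module ℂ V]
    [FiniteDimensional ℂ V] (S : Submodule ℂ V) {A B : Submodule ℂ V} (h : A ≤ B) :
    Module.finrank ℂ (B ⊓ S : Submodule ℂ V) + Module.finrank ℂ A
      ≤ Module.finrank ℂ B + Module.finrank ℂ (A ⊓ S : Submodule ℂ V) := by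
  have h1 := Submodule.finrank_sup_add_finrank_inf_eq (B ⊓ S) A
  have h2 : (B ⊓ S) ⊓ A = A ⊓ S := by
    rw [inf_right_comm, inf_eq_right.mpr h]
  have h3 : Module.finrank ℂ ((B ⊓ S) ⊔ A : Submodule ℂ V) ≤ Module.finrank ℂ B :=
    Submodule.finrank_mono (sup_le inf_le_left h)
  rw [h2] at h1
  omega

theorem finrank_map_mkQ_add {V : Type u₂} [AddCommGroup V] [Module ℂ V]
    [FiniteDimensional ℂ V] (S A : Submodule ℂ V) :
    Module.finrank ℂ (A.map S.mkQ) + Module.finrank ℂ (A ⊓ S : Submodule ℂ V)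
      = Module.finrank ℂ A := by
  have h := LinearMap.finrank_range_add_finrank_ker (S.mkQ.domRestrict A)
  have hr : LinearMap.range (S.mkQ.domRestrict A) = A.map S.mkQ := by
    rw [LinearMap.domRestrict, LinearMap.range_comp, Submodule.range_subtype]
  have hk : LinearMap.ker (S.mkQ.domRestrict A) = S.comap A.subtype := by
    rw [LinearMap.domRestrict, LinearMap.ker_comp, Submodule.ker_mkQ]
  rw [hr, hk, finrank_comap_subtype_eq, inf_comm] at h
  exact h

/-- The filtration `F_S(i) = F(i) ∩ S` inherited by a subspace `S ⊆ V`. -/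
def Filtration.sub {V : Type u₂} [AddCommGroup V] [Module ℂ V] [FiniteDimensional ℂ V]
    (F : Filtration V) (S : Submodule ℂ V) : Filtration S where
  toFun i := (F i).comap S.subtype
  zero_eq_bot := by
    rw [F.zero_eq_bot, ← LinearMap.ker, Submodule.ker_subtype]
  monotone := fun _ _ h => Submodule.comap_mono (F.monotone h)
  exists_eq_top := by
    obtain ⟨ℓ, hℓ⟩ := F.exists_eq_top
    exact ⟨ℓ, by rw [hℓ, Submodule.comap_top]⟩
  finrank_succ_le i := by
    rw [finrank_comap_subtype_eq, finrank_comap_subtype_eq]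
    have h1 := finrank_inf_add_le S (F.monotone (Nat.le_succ i))
    have h2 := F.finrank_succ_le i
    simp only [Nat.succ_eq_add_one] at h1
    omega

/-- The filtration `F_{V/S}(i) = (F(i) + S)/S` inherited by a quotient `V/S`. -/
def Filtration.quot {V : Type u₂} [AddCommGroup V] [Module ℂ V] [FiniteDimensional ℂ V]
    (F : Filtration V) (S : Submodule ℂ V) : Filtration (V ⧸ S) where
  toFun i := (F i).map S.mkQ
  zero_eq_bot := by rw [F.zero_eq_bot, Submodule.map_bot]
  monotone := fun _ _ h => Submodule.map_mono (F.monotone h)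
  exists_eq_top := by
    obtain ⟨ℓ, hℓ⟩ := F.exists_eq_top
    exact ⟨ℓ, by rw [hℓ, Submodule.map_top, Submodule.range_mkQ]⟩
  finrank_succ_le i := by
    have h1 := finrank_map_mkQ_add S (F i)
    have h2 := finrank_map_mkQ_add S (F (i + 1))
    have h3 : Module.finrank ℂ (F i ⊓ S : Submodule ℂ V)
        ≤ Module.finrank ℂ (F (i + 1) ⊓ S : Submodule ℂ V) :=
      Submodule.finrank_mono (inf_le_inf_right S (F.monotone (Nat.le_succ i)))
    have h4 := F.finrank_succ_le i
    omega

/-! ### Grassmannians -/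

/-- The Grassmannian of `r`-dimensional subspaces of a complex vector space `V`. -/
def Gr (r : ℕ) (V : Type u₂) [AddCommGroup V] [Module ℂ V] : Type u₂ :=
  {N : Submodule ℂ V // Module.finrank ℂ N = r}

/-- The `r`-frames of `V`, i.e. linearly independent `r`-tuples of vectors. -/
def Frame (r : ℕ) (V : Type u₂) [AddCommGroup V] [Module ℂ V] : Type u₂ :=
  {f : Fin r → V // LinearIndependent ℂ f}

/-- The topology on frames induced by the canonical vector space topology of `V`. -/
instance Frame.topologicalSpace (r : ℕ) (V : Type u₂) [AddCommGroup V] [Module ℂ V] :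
    TopologicalSpace (Frame r V) :=
  letI : TopologicalSpace V := moduleTopology ℂ V
  inferInstanceAs (TopologicalSpace {f : Fin r → V // LinearIndependent ℂ f})

/-- The subspace spanned by a frame. -/
def Frame.span {r : ℕ} {V : Type u₂} [AddCommGroup V] [Module ℂ V] (f : Frame r V) : Gr r V :=
  ⟨Submodule.span ℂ (Set.range f.1), by simpa using finrank_span_eq_card f.2⟩

/-- The usual topology of the Grassmannian, as a quotient of the space of frames. -/
instance Gr.topologicalSpace (r : ℕ) (V : Type u₂) [AddCommGroup V] [Module ℂ V] :
    TopologicalSpace (Gr r V) :=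
  TopologicalSpace.coinduced Frame.span inferInstance

section Families

variable {Q₀ : Type u₀} [Quiver.{u₁} Q₀]

/-- `Gr(α, 𝒱) = ∏ₓ Gr(αₓ, Vₓ)` (with the product topology). -/
abbrev GrFam (α : Q₀ → ℕ) (V : Q₀ → Type u₂) [∀ x, AddCommGroup (V x)]
    [∀ x, Module ℂ (V x)] : Type (max u₀ u₂) :=
  ∀ x, Gr (α x) (V x)

/-! ### Quiver representations and Schubert varieties -/

/-- `ℋ_Q(𝒱, 𝒲) = ⨁_{a : x → y} Hom(Vₓ, W_y)`. -/
abbrev HQ (V : Q₀ → Type u₂) (W : Q₀ → Type u₃)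
    [∀ x, AddCommGroup (V x)] [∀ x, Module ℂ (V x)]
    [∀ x, AddCommGroup (W x)] [∀ x, Module ℂ (W x)] : Type (max u₀ u₁ u₂ u₃) :=
  ∀ (x y : Q₀), (x ⟶ y) → (V x →ₗ[ℂ] W y)

/-- `𝔤_Q(𝒱, 𝒲) = ⨁ₓ Hom(Vₓ, Wₓ)`. -/
abbrev gQ (V : Q₀ → Type u₂) (W : Q₀ → Type u₃)
    [∀ x, AddCommGroup (V x)] [∀ x, Module ℂ (V x)]
    [∀ x, AddCommGroup (W x)] [∀ x, Module ℂ (W x)] : Type (max u₀ u₂ u₃) :=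
  ∀ x : Q₀, V x →ₗ[ℂ] W x

variable {V : Q₀ → Type u₂} [∀ x, AddCommGroup (V x)] [∀ x, Module ℂ (V x)]
variable {W : Q₀ → Type u₃} [∀ x, AddCommGroup (W x)] [∀ x, Module ℂ (W x)]

/-- The family of subspaces `N` is a subrepresentation of `(𝒱, v)`. -/
def IsSubrep (v : HQ V V) (N : ∀ x, Submodule ℂ (V x)) : Prop :=
  ∀ (x y : Q₀) (a : x ⟶ y), (N x).map (v x y a) ≤ N y

/-- The Borel subgroup `B_Q(𝒱, ℱ)` of `GL_Q(𝒱) = ∏ₓ GL(Vₓ)`: the stabilizer of the filtrations. -/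
def borel (F : ∀ x, Filtration (V x)) : Subgroup (∀ x, V x ≃ₗ[ℂ] V x) where
  carrier := {g | ∀ x i, (F x i).map (g x : V x →ₗ[ℂ] V x) = F x i}
  one_mem' := fun x i => Submodule.map_id (F x i)
  mul_mem' := by
    intro g h hg hh x i
    have : (((g * h) x : V x ≃ₗ[ℂ] V x) : V x →ₗ[ℂ] V x)
        = (g x : V x →ₗ[ℂ] V x) ∘ₗ (h x : V x →ₗ[ℂ] V x) := rfl
    rw [this, Submodule.map_comp, hh x i, hg x i]
  inv_mem' := by
    intro g hg x i
    have : ((g⁻¹ x : V x ≃ₗ[ℂ] V x) : V x →ₗ[ℂ] V x) ∘ₗ (g x : V x →ₗ[ℂ] V x)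
        = LinearMap.id := LinearMap.ext fun z => (g x).symm_apply_apply z
    conv_lhs => rw [← hg x i]
    rw [← Submodule.map_comp, this, Submodule.map_id]

/-- The orbit of the family of subspaces `S` under `B_Q(𝒱, ℱ)`, a product of Schubert cells. -/
def schubertCell (F : ∀ x, Filtration (V x)) (S : ∀ x, Submodule ℂ (V x)) :
    Set (GrFam (fun x => Module.finrank ℂ (S x)) V) :=
  {N | ∃ g ∈ borel F, ∀ x, (N x).1 = (S x).map (g x : V x →ₗ[ℂ] V x)}

/-- The Schubert variety `Ω(𝒮, ℱ)`: the closure of the orbit of `𝒮`. -/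
def schubertVariety (F : ∀ x, Filtration (V x)) (S : ∀ x, Submodule ℂ (V x)) :
    Set (GrFam (fun x => Module.finrank ℂ (S x)) V) :=
  closure (schubertCell F S)

/-- `Ω ⊆ Gr(α, 𝒱)` is `Q`-intersecting: every representation `v` of `Q` on `𝒱` has a
subrepresentation belonging to `Ω`. -/
def IsQIntersecting {α : Q₀ → ℕ} (Ω : Set (GrFam α V)) : Prop :=
  ∀ v : HQ V V, ∃ N ∈ Ω, IsSubrep v (fun x => (N x).1)

/-- `𝒮 ⊆_Q 𝒱`, with respect to the filtrations `ℱ` on `𝒱`. -/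
def QSub (F : ∀ x, Filtration (V x)) (S : ∀ x, Submodule ℂ (V x)) : Prop :=
  IsQIntersecting (schubertVariety F S)

/-! ### Filtered `Ext` -/

/-- The space `𝔤_{Q,ℱ,𝒢}(𝒱, 𝒲)` of maps compatible with the filtrations. -/
def gQFil (F : ∀ x, Filtration (V x)) (G : ∀ x, Filtration (W x)) :
    Submodule ℂ (gQ V W) where
  carrier := {φ | ∀ x i, ∀ z ∈ F x i, φ x z ∈ G x i}
  zero_mem' := fun x i _ _ => (G x i).zero_mem
  add_mem' := fun hφ hψ x i z hz => (G x i).add_mem (hφ x i z hz) (hψ x i z hz)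
  smul_mem' := fun c _ hφ x i z hz => (G x i).smul_mem c (hφ x i z hz)

/-- The filtered Euler number
`eul_{Q,ℱ,𝒢}(𝒱, 𝒲) = dim 𝔤_{Q,ℱ,𝒢}(𝒱, 𝒲) - dim ℋ_Q(𝒱, 𝒲)`. -/
def eul (F : ∀ x, Filtration (V x)) (G : ∀ x, Filtration (W x)) : ℤ :=
  (Module.finrank ℂ (gQFil F G) : ℤ) - (Module.finrank ℂ (HQ V W) : ℤ)

/-- The map `Φ ↦ Φ v - w Φ`, i.e. `a : x → y` is sent to `Φ_y v_a - w_a Φ_x`. -/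
def commMap (v : HQ V V) (w : HQ W W) : gQ V W →ₗ[ℂ] HQ V W where
  toFun φ := fun x y a => φ y ∘ₗ v x y a - w x y a ∘ₗ φ x
  map_add' φ ψ := by
    funext x y a
    ext z
    simp only [LinearMap.sub_apply, LinearMap.comp_apply, Pi.add_apply, LinearMap.add_apply,
      map_add]
    abel
  map_smul' c φ := by
    funext x y a
    ext z
    simp [smul_sub]

/-- The map `δ_{v,w} : 𝔤_{Q,ℱ,𝒢}(𝒱, 𝒲) → ℋ_Q(𝒱, 𝒲)`, `Φ ↦ Φ v - w Φ`. -/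
def delta (F : ∀ x, Filtration (V x)) (G : ∀ x, Filtration (W x))
    (v : HQ V V) (w : HQ W W) : gQFil F G →ₗ[ℂ] HQ V W :=
  (commMap v w).domRestrict (gQFil F G)

/-- `Ext_{Q,ℱ,𝒢}(v, w)`, the cokernel of `δ_{v,w}`. -/
abbrev Ext (F : ∀ x, Filtration (V x)) (G : ∀ x, Filtration (W x))
    (v : HQ V V) (w : HQ W W) : Type (max u₀ u₁ u₂ u₃) :=
  HQ V W ⧸ LinearMap.range (delta F G v w)

/-- `ext_{Q,ℱ,𝒢}(𝒱, 𝒲)`, the minimum of `dim Ext_{Q,ℱ,𝒢}(v, w)` over all `v` and `w`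
(an infimum over a nonempty set of natural numbers, hence attained). -/
def genericExt (F : ∀ x, Filtration (V x)) (G : ∀ x, Filtration (W x)) : ℕ :=
  ⨅ p : HQ V V × HQ W W, Module.finrank ℂ (Ext F G p.1 p.2)

end Families

end

end FilteredQuiver

/-! ### Dimension and dominance for polynomial maps between affine spaces. -/

namespace FilteredQuiver

open MvPolynomial

/-! Vanishing of `genericExt` means that some `delta F G v w` is surjective. If so, restrict to a
subrepresentation N of v in the Schubert variety of S: surjectivity is inherited by N, so eul(N, W)
≥ 0. Points of a Schubert variety meet each F(i) in dimension at least that of S, and by Abel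
summation the Euler number decreases in these dimensions once the total dimension is fixed; hence
eul(S, W) ≥ eul(N, W) ≥ 0. This is part 1.

For part 2, suppose no δ is surjective. The first ingredient (`exists_subEul_neg`) is that every
representation v has a subrepresentation N with eul(N, W) < 0. Take (v, w) generic. If δ is
injective, then N = V works by counting dimensions. Otherwise pick φ ≠ 0 in its kernel. By a
first-order deformation of w (`surjective_delta_of_ker`), non-surjectivity passes to ker φ, a proper
subrepresentation, and induction on the dimension applies. Arbitrary v are reached as limits,
because Grassmannians are compact and positions only grow in the limit.

The second ingredient replaces N by a canonical subrepresentation. The Euler number is submodular on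
subfamilies, so K·eul + dim, with K larger than dim V, has a unique minimizer among the
subrepresentations of v, and that minimizer has negative Euler number as soon as some
subrepresentation has. Only finitely many positions occur. For each position, with representative S,
the pairs (point of the cell of S, representation preserving it) are parametrized by `nilFam` ×
`stabilizing`, whose dimension is dim H(V) + eul(S, V/S). By uniqueness of minimizers, the map to
H(V) has one-point fibres over representations whose minimizer has that position. One position must
occur on a Zariski dense set (`exists_dominant_of_cover`): there dominance gives S ⊆_Q V and
equality of dimensions gives eul(S, V/S) = 0. Since eul(S, W) < 0, the hypothesis of part 2 is
violated. -/

theorem height_vanishingIdeal_singleton_eq {σ : Type*} [Finite σ] (x y : σ → ℂ) :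
    (vanishingIdeal ℂ {x} : Ideal (MvPolynomial σ ℂ)).height
      = (vanishingIdeal ℂ {y} : Ideal (MvPolynomial σ ℂ)).height := by
  -- Translation by x - y, an automorphism of affine space carrying y to x.
  let e : MvPolynomial σ ℂ ≃ₐ[ℂ] MvPolynomial σ ℂ :=
    AlgEquiv.ofAlgHom (aeval fun i => X i + C (x i - y i)) (aeval fun i => X i + C (y i - x i))
      (by ext1 i; simp [sub_eq_add_neg]; ring) (by ext1 i; simp [sub_eq_add_neg]; ring)
  have h : (vanishingIdeal ℂ {x} : Ideal (MvPolynomial σ ℂ))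
      = (vanishingIdeal ℂ {y} : Ideal (MvPolynomial σ ℂ)).comap e.toRingEquiv := by
    ext p
    rw [Ideal.mem_comap]
    have : aeval y (e p) = aeval x p := by
      have : (aeval y).comp (e : MvPolynomial σ ℂ →ₐ[ℂ] MvPolynomial σ ℂ)
          = (aeval x : MvPolynomial σ ℂ →ₐ[ℂ] ℂ) := by
        ext i; simp [e]
      exact DFunLike.congr_fun this p
    simp only [mem_vanishingIdeal_singleton_iff]
    change _ ↔ aeval y (e p) = 0
    rw [this]
  rw [h, RingEquiv.height_comap]

/-- A polynomial map with a one-point fibre does not lower the dimension. -/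
theorem card_le_of_fiber_unique {σ ι : Type*} [Finite σ] [Finite ι]
    (p : ι → MvPolynomial σ ℂ) (x : σ → ℂ)
    (hx : ∀ x' : σ → ℂ, (∀ i, eval x' (p i) = eval x (p i)) → x' = x) :
    Nat.card σ ≤ Nat.card ι := by
  classical
  set I : Ideal (MvPolynomial σ ℂ) := Ideal.span (Set.range fun i => p i - C (eval x (p i)))
  have hz : zeroLocus ℂ I = {x} := by
    ext z
    rw [zeroLocus_span]
    simp only [Set.mem_range, forall_exists_index, forall_apply_eq_imp_iff, Set.mem_ofPred_eq,
      Set.mem_singleton_iff]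
    constructor
    · intro h
      refine hx z fun i => ?_
      have := h i
      simpa [sub_eq_zero, aeval_eq_eval] using this
    · rintro rfl i
      simp [aeval_eq_eval]
  have hr : I.radical = vanishingIdeal ℂ {x} := by
    rw [← vanishingIdeal_zeroLocus_eq_radical (K := ℂ), hz]
  -- The fibre through x is cut out by |ι| equations and has x as its only point, so by the
  -- Nullstellensatz the maximal ideal of x is minimal over I and Krull's height theorem bounds its
  -- height by |ι|.
  have hmin : (vanishingIdeal ℂ {x} : Ideal (MvPolynomial σ ℂ)) ∈ I.minimalPrimes := by
    rw [← Ideal.radical_minimalPrimes, hr, Ideal.minimalPrimes_eq_subsingleton_self]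
    rfl
  have h1 := Ideal.height_le_spanRank_toENat_of_mem_minimalPrimes I _ hmin
  have h2 : I.spanRank.toENat ≤ (Nat.card ι : ℕ∞) := by
    have := Submodule.spanRank_span_le_card (R := MvPolynomial σ ℂ)
      (Set.range fun i => p i - C (eval x (p i)))
    refine (Cardinal.toENat.monotone' this).trans ?_
    rw [← ENat.card_eq_coe_natCard, ← Set.encard_univ, ← Set.image_univ]
    exact Set.encard_image_le _ _
  -- All maximal ideals have the same height by translation, so the bound at x bounds the dimension
  -- of the whole affine space.
  have h3 : ringKrullDim (MvPolynomial σ ℂ) ≤ (Nat.card ι : ℕ∞) := by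
    rw [ringKrullDim_le_iff_isMaximal_height_le]
    intro M hM
    obtain ⟨z, rfl⟩ := (isMaximal_iff_eq_vanishingIdeal_singleton (I := M)).1 hM
    rw [height_vanishingIdeal_singleton_eq z x]
    exact_mod_cast h1.trans h2
  rw [MvPolynomial.ringKrullDim_of_isNoetherianRing, ringKrullDim_eq_zero_of_field, zero_add] at h3
  exact_mod_cast h3

theorem card_le_of_algebraicIndependent {σ ι : Type*} [Finite σ] [Finite ι]
    (p : ι → MvPolynomial σ ℂ) (hp : AlgebraicIndependent ℂ p) : Nat.card ι ≤ Nat.card σ := by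
  have h := hp.lift_cardinalMk_le_trdeg
  rw [MvPolynomial.trdeg_of_isDomain] at h
  rw [← Nat.cast_card (α := ι), ← Nat.cast_card (α := σ)] at h
  simpa using h

/-- A locally closed piece containing the generic point has only zero among its closed conditions,
so it is a principal open set. -/
theorem exists_basicOpen_subset_of_mem_isConstructible {R : Type*} [CommRing R] [IsDomain R]
    {s : Set (PrimeSpectrum R)} (hs : Topology.IsConstructible s) (h : (⊥ : PrimeSpectrum R) ∈ s) :
    ∃ a : R, a ≠ 0 ∧ (PrimeSpectrum.basicOpen a : Set (PrimeSpectrum R)) ⊆ s := by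
  obtain ⟨S, rfl⟩ := PrimeSpectrum.exists_constructibleSetData_iff.mpr hs
  simp only [PrimeSpectrum.ConstructibleSetData.toSet, Set.mem_iUnion] at h
  obtain ⟨c, hc, h1, h2⟩ := h
  have hf : c.f ≠ 0 := by
    intro h0
    apply h2
    simp [h0]
  refine ⟨c.f, hf, fun q hq => ?_⟩
  simp only [PrimeSpectrum.ConstructibleSetData.toSet, Set.mem_iUnion]
  refine ⟨c, hc, fun z hz => ?_, ?_⟩
  · have : z = 0 := by simpa using h1 hz
    rw [this]
    exact q.asIdeal.zero_mem
  · simpa [PrimeSpectrum.mem_zeroLocus] using hq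

/-- The image of a dominant polynomial map contains a nonempty principal open set. -/
theorem exists_ne_zero_forall_exists_eval_eq {σ ι : Type*} [Finite σ] [Finite ι]
    (p : ι → MvPolynomial σ ℂ) (hp : AlgebraicIndependent ℂ p) :
    ∃ a : MvPolynomial ι ℂ, a ≠ 0 ∧
      ∀ y : ι → ℂ, eval y a ≠ 0 → ∃ x : σ → ℂ, ∀ i, eval x (p i) = y i := by
  let f : MvPolynomial ι ℂ →ₐ[ℂ] MvPolynomial σ ℂ := aeval p
  have hinj : Function.Injective f := hp
  have hfp : f.toRingHom.FinitePresentation := by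
    apply RingHom.FinitePresentation.of_finiteType.1
    apply RingHom.FiniteType.of_comp_finiteType (f := algebraMap ℂ (MvPolynomial ι ℂ))
    have : f.toRingHom.comp (algebraMap ℂ (MvPolynomial ι ℂ)) = algebraMap ℂ _ := f.comp_algebraMap
    rw [this, RingHom.finiteType_algebraMap]
    infer_instance
  obtain ⟨a, ha, hs⟩ := exists_basicOpen_subset_of_mem_isConstructible
    (PrimeSpectrum.isConstructible_range_comap hfp)
    ⟨⊥, by
      ext z
      change f z ∈ (⊥ : Ideal _) ↔ z ∈ (⊥ : Ideal _)
      simp [map_eq_zero_iff f hinj]⟩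
  refine ⟨a, ha, fun y hy => ?_⟩
  obtain ⟨q, hq⟩ := hs (show pointToPoint y ∈ PrimeSpectrum.basicOpen a by
    rw [PrimeSpectrum.mem_basicOpen]
    change a ∉ (vanishingIdeal ℂ {y} : Ideal (MvPolynomial ι ℂ))
    simpa [mem_vanishingIdeal_singleton_iff, aeval_eq_eval] using hy)
  -- The prime q over y need not be a closed point; a maximal ideal above it still contains the
  -- images of all X i - y i, so it is a genuine point of the fibre.
  obtain ⟨M, hM, hqM⟩ := Ideal.exists_le_maximal q.asIdeal q.2.ne_top
  obtain ⟨x, rfl⟩ := (isMaximal_iff_eq_vanishingIdeal_singleton (I := M)).1 hM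
  refine ⟨x, fun i => ?_⟩
  have h1 : (X i - C (y i) : MvPolynomial ι ℂ) ∈ (PrimeSpectrum.comap f.toRingHom q).asIdeal := by
    rw [hq]
    change _ ∈ (vanishingIdeal ℂ {y} : Ideal (MvPolynomial ι ℂ))
    simp
  have h2 : f (X i - C (y i)) ∈ (vanishingIdeal ℂ {x} : Ideal (MvPolynomial σ ℂ)) := hqM h1
  rw [mem_vanishingIdeal_singleton_iff] at h2
  simpa [f, sub_eq_zero, aeval_eq_eval] using h2

/-! ### Polynomial maps between vector spaces -/

section PolyMap

variable {E : Type*} [AddCommGroup E] [Module ℂ E] [FiniteDimensional ℂ E]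

/-- Polynomial functions on a finite-dimensional vector space. -/
def IsPolyFun (f : E → ℂ) : Prop :=
  ∃ p : MvPolynomial (Fin (Module.finrank ℂ E)) ℂ,
    ∀ x, f x = eval (Module.finBasis ℂ E |>.equivFun x) p

theorem IsPolyFun.const (c : ℂ) : IsPolyFun (fun _ : E => c) := ⟨C c, fun x => by simp⟩

theorem IsPolyFun.add {f g : E → ℂ} (hf : IsPolyFun f) (hg : IsPolyFun g) :
    IsPolyFun (fun x => f x + g x) := by
  obtain ⟨p, hp⟩ := hf
  obtain ⟨q, hq⟩ := hg
  exact ⟨p + q, fun x => by simp [hp, hq]⟩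

theorem IsPolyFun.mul {f g : E → ℂ} (hf : IsPolyFun f) (hg : IsPolyFun g) :
    IsPolyFun (fun x => f x * g x) := by
  obtain ⟨p, hp⟩ := hf
  obtain ⟨q, hq⟩ := hg
  exact ⟨p * q, fun x => by simp [hp, hq]⟩

theorem IsPolyFun.sum {ι : Type*} (s : Finset ι) {f : ι → E → ℂ} (hf : ∀ i, IsPolyFun (f i)) :
    IsPolyFun (fun x => ∑ i ∈ s, f i x) := by
  classical
  induction s using Finset.induction_on with
  | empty => simpa using IsPolyFun.const 0
  | insert a s ha ih => simpa [Finset.sum_insert ha] using (hf a).add ih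

theorem IsPolyFun.linear (l : E →ₗ[ℂ] ℂ) : IsPolyFun (fun x => l x) := by
  refine ⟨∑ i, C (l (Module.finBasis ℂ E i)) * X i, fun x => ?_⟩
  calc l x = l (∑ i, (Module.finBasis ℂ E).equivFun x i • Module.finBasis ℂ E i) := by
        rw [Module.Basis.sum_equivFun]
    _ = _ := by
        rw [map_sum, map_sum]
        refine Finset.sum_congr rfl fun i _ => ?_
        rw [map_smul, smul_eq_mul, map_mul, eval_C, eval_X, mul_comm]

variable {F : Type*} [AddCommGroup F] [Module ℂ F]
variable {F' : Type*} [AddCommGroup F'] [Module ℂ F']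
variable {F'' : Type*} [AddCommGroup F''] [Module ℂ F'']

/-- Polynomial maps between finite-dimensional vector spaces. -/
def IsPolyMap (f : E → F) : Prop := ∀ l : F →ₗ[ℂ] ℂ, IsPolyFun fun x => l (f x)

theorem IsPolyMap.linear (l : E →ₗ[ℂ] F) : IsPolyMap (fun x => l x) :=
  fun m => IsPolyFun.linear (m ∘ₗ l)

theorem IsPolyMap.const (c : F) : IsPolyMap (fun _ : E => c) := fun _ => IsPolyFun.const _

theorem IsPolyMap.add {f g : E → F} (hf : IsPolyMap f) (hg : IsPolyMap g) :
    IsPolyMap (fun x => f x + g x) := fun l => by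
  simpa using (hf l).add (hg l)

theorem IsPolyMap.bilinear [FiniteDimensional ℂ F] [FiniteDimensional ℂ F']
    (B : F →ₗ[ℂ] F' →ₗ[ℂ] F'') {f : E → F} {g : E → F'}
    (hf : IsPolyMap f) (hg : IsPolyMap g) : IsPolyMap (fun x => B (f x) (g x)) := fun l => by
  have : (fun x => l (B (f x) (g x))) = fun x =>
      ∑ i, (Module.finBasis ℂ F).coord i (f x) * ∑ j, (Module.finBasis ℂ F').coord j (g x) *
        l (B (Module.finBasis ℂ F i) (Module.finBasis ℂ F' j)) := by
    funext x
    calc l (B (f x) (g x)) = l (B (∑ i, (Module.finBasis ℂ F).coord i (f x) • Module.finBasis ℂ F i)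
          (∑ j, (Module.finBasis ℂ F').coord j (g x) • Module.finBasis ℂ F' j)) := by
          simp only [Module.Basis.coord_apply, Module.Basis.sum_repr]
      _ = _ := by
          rw [LinearMap.map_sum₂, map_sum]
          refine Finset.sum_congr rfl fun i _ => ?_
          rw [map_smul, LinearMap.smul_apply, map_smul, smul_eq_mul, map_sum, map_sum]
          congr 1
          refine Finset.sum_congr rfl fun j _ => ?_
          rw [map_smul, map_smul, smul_eq_mul]
  rw [this]
  exact IsPolyFun.sum _ fun i => (hf _).mul <| IsPolyFun.sum _ fun j => (hg _).mul (.const _)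

theorem IsPolyMap.neg {f : E → F} (hf : IsPolyMap f) : IsPolyMap (fun x => - f x) := fun l => by
  simpa using (IsPolyFun.const (-1)).mul (hf l)

theorem IsPolyMap.sub {f g : E → F} (hf : IsPolyMap f) (hg : IsPolyMap g) :
    IsPolyMap (fun x => f x - g x) := by
  simpa [sub_eq_add_neg] using hf.add hg.neg

theorem isPolyMap_pi {ι : Type*} [Finite ι] {F : ι → Type*} [∀ i, AddCommGroup (F i)]
    [∀ i, Module ℂ (F i)] {f : E → ∀ i, F i}
    (hf : ∀ i, IsPolyMap fun x => f x i) : IsPolyMap f := fun l => by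
  classical
  cases nonempty_fintype ι
  have : (fun x => l (f x)) = fun x => ∑ i, (l ∘ₗ LinearMap.single ℂ F i) (f x i) := by
    funext x
    simp only [LinearMap.comp_apply, ← map_sum]
    congr 1
    exact (LinearMap.sum_single_apply F (f x)).symm
  rw [this]
  exact IsPolyFun.sum _ fun i => hf i _

/-- A nonzero polynomial function vanishes at only finitely many points of a line through a
point at which it does not vanish. -/
theorem IsPolyFun.finite_zeros_line {a : E → ℂ} (ha : IsPolyFun a) {x : E} (hx : a x ≠ 0) (u : E) :
    {t : ℂ | a (x + t • u) = 0}.Finite := by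
  obtain ⟨p, hp⟩ := ha
  let b := (Module.finBasis ℂ E).equivFun
  let q : Polynomial ℂ :=
    aeval (fun i => Polynomial.C (b x i) + Polynomial.X * Polynomial.C (b u i)) p
  have hq : ∀ t, q.eval t = a (x + t • u) := by
    intro t
    rw [hp]
    have h : (Polynomial.aeval t).comp
        (aeval fun i => Polynomial.C (b x i) + Polynomial.X * Polynomial.C (b u i))
        = (aeval (b (x + t • u)) : MvPolynomial _ ℂ →ₐ[ℂ] ℂ) := by
      ext i
      simp only [AlgHom.comp_apply, aeval_X, map_add, map_mul, Polynomial.aeval_C,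
        Polynomial.aeval_X, map_smul, Pi.add_apply, Pi.smul_apply, smul_eq_mul,
        Algebra.algebraMap_self, RingHom.id_apply]
    have := DFunLike.congr_fun h p
    rw [AlgHom.comp_apply, Polynomial.coe_aeval_eq_eval, aeval_eq_eval] at this
    exact this
  have hq0 : q ≠ 0 := by
    intro h0
    apply hx
    have := hq 0
    rw [h0] at this
    simpa using this.symm
  refine (q.roots.toFinset.finite_toSet).subset fun t ht => ?_
  simp only [Finset.mem_coe, Multiset.mem_toFinset, Polynomial.mem_roots hq0, Polynomial.IsRoot]
  rw [hq]
  exact ht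

/-- If finitely many subsets `A i` cover a vector space and are contained in the images of
polynomial maps with one-point fibres over `A i`, then one of these maps preserves the dimension,
and its image contains the nonvanishing set of a nonzero polynomial function. -/
theorem exists_dominant_of_cover {T : Type*} [Finite T] {D : T → Type*} [∀ i, AddCommGroup (D i)]
    [∀ i, Module ℂ (D i)] [∀ i, FiniteDimensional ℂ (D i)] (P : ∀ i, D i → E)
    (hP : ∀ i, IsPolyMap (P i)) (A : T → Set E) (hA : ∀ y, ∃ i, y ∈ A i)
    (hPA : ∀ i, ∀ y ∈ A i, ∃! x, P i x = y) :
    ∃ i, (A i).Nonempty ∧ Module.finrank ℂ (D i) = Module.finrank ℂ E ∧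
      ∃ a : E → ℂ, IsPolyFun a ∧ (∃ x, a x ≠ 0) ∧ ∀ y, a y ≠ 0 → y ∈ Set.range (P i) := by
  classical
  cases nonempty_fintype T
  let b := (Module.finBasis ℂ E).equivFun
  -- Some A i is Zariski dense: otherwise the product of nonzero polynomials vanishing on the
  -- respective A i would vanish everywhere.
  have key : ∃ i, ∀ q : MvPolynomial (Fin (Module.finrank ℂ E)) ℂ,
      (∀ y ∈ A i, eval (b y) q = 0) → q = 0 := by
    by_contra! hcon
    choose q hq hq0 using hcon
    have h0 : ∏ i, q i = 0 := by
      apply MvPolynomial.funext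
      intro z
      obtain ⟨i, hi⟩ := hA (b.symm z)
      rw [map_prod, map_zero]
      refine Finset.prod_eq_zero (Finset.mem_univ i) ?_
      simpa using hq i _ hi
    rw [Finset.prod_eq_zero_iff] at h0
    obtain ⟨i, -, hi⟩ := h0
    exact hq0 i hi
  obtain ⟨i, hi⟩ := key
  have hne : (A i).Nonempty := by
    by_contra h
    rw [Set.not_nonempty_iff_eq_empty] at h
    exact one_ne_zero (hi 1 (by simp [h]))
  let c := (Module.finBasis ℂ (D i)).equivFun
  choose p hp using fun j => hP i ((Module.finBasis ℂ E).coord j)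
  have hp' : ∀ x j, b (P i x) j = eval (c x) (p j) := fun x j => hp j x
  have halg : AlgebraicIndependent ℂ p := by
    rw [algebraicIndependent_iff]
    intro q hq
    apply hi
    intro y hy
    obtain ⟨x, rfl, -⟩ := hPA i y hy
    have h1 : (aeval (c x)).comp (aeval p) = (aeval (b (P i x)) : MvPolynomial _ ℂ →ₐ[ℂ] ℂ) := by
      ext j; simp [hp', aeval_eq_eval]
    have h2 := DFunLike.congr_fun h1 q
    rw [AlgHom.comp_apply, hq] at h2
    simpa [aeval_eq_eval] using h2.symm
  refine ⟨i, hne, le_antisymm ?_ ?_, ?_⟩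
  · obtain ⟨y, hy⟩ := hne
    obtain ⟨x, rfl, hx⟩ := hPA i y hy
    have := card_le_of_fiber_unique p (c x) fun x' hx' => by
      have : c.symm x' = x := by
        refine hx _ (b.injective (funext fun j => ?_))
        rw [hp', hp', LinearEquiv.apply_symm_apply, hx']
      rw [← this, LinearEquiv.apply_symm_apply]
    simpa using this
  · simpa using card_le_of_algebraicIndependent p halg
  · obtain ⟨a, ha, haP⟩ := exists_ne_zero_forall_exists_eval_eq p halg
    refine ⟨fun y => eval (b y) a, ⟨a, fun _ => rfl⟩, ?_, fun y hy => ?_⟩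
    · by_contra! h
      exact ha (MvPolynomial.funext fun z => by simpa using h (b.symm z))
    · obtain ⟨x, hx⟩ := haP (b y) hy
      refine ⟨c.symm x, b.injective (funext fun j => ?_)⟩
      rw [hp', LinearEquiv.apply_symm_apply, hx]

end PolyMap

end FilteredQuiver

namespace FilteredQuiver

open Module

/-! ### Generic points on lines -/

/-- A set containing, with each of its points, all but finitely many points of every complex line
through that point. -/
def LineOpen {E : Type*} [AddCommGroup E] [Module ℂ E] (A : Set E) : Prop :=
  ∀ x ∈ A, ∀ u : E, {t : ℂ | x + t • u ∉ A}.Finite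

section LineOpen

variable {E : Type*} [AddCommGroup E] [Module ℂ E]

theorem LineOpen.inter {A B : Set E} (hA : LineOpen A) (hB : LineOpen B) : LineOpen (A ∩ B) := by
  rintro x ⟨hxA, hxB⟩ u
  refine ((hA x hxA u).union (hB x hxB u)).subset fun t ht => ?_
  by_contra h
  simp only [Set.mem_union, Set.mem_ofPred_eq, not_or, not_not] at h
  exact ht h

/-- On the line joining a point of A to a point of B, each set misses only finitely many parameters.
`LineOpen` thus replaces Zariski openness of generic conditions. -/
theorem LineOpen.nonempty_inter {A B : Set E} (hA : LineOpen A) (hB : LineOpen B)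
    (hA' : A.Nonempty) (hB' : B.Nonempty) : (A ∩ B).Nonempty := by
  obtain ⟨x, hx⟩ := hA'
  obtain ⟨y, hy⟩ := hB'
  have h1 := hA x hx (y - x)
  have h2 := (hB y hy (x - y)).image (fun t => 1 - t)
  obtain ⟨t, ht⟩ := (h1.union h2).infinite_compl.nonempty
  simp only [Set.mem_compl_iff, Set.mem_union, Set.mem_image, not_or, Set.mem_ofPred_eq, not_not,
    not_exists, not_and] at ht
  refine ⟨x + t • (y - x), ht.1, ?_⟩
  by_contra h
  refine ht.2 (1 - t) (fun h' => h ?_) (by ring)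
  convert h' using 1
  module

theorem LineOpen.iInter {ι : Type*} [Finite ι] {A : ι → Set E} (hA : ∀ i, LineOpen (A i)) :
    LineOpen (⋂ i, A i) := by
  intro x hx u
  refine (Set.finite_iUnion fun i => hA i x (Set.mem_iInter.1 hx i) u).subset fun t ht => ?_
  simpa using ht

theorem LineOpen.nonempty_biInter {ι : Type*} [Finite ι] {A : ι → Set E}
    (hA : ∀ i, LineOpen (A i)) (hA' : ∀ i, (A i).Nonempty) : (⋂ i, A i).Nonempty := by
  classical
  cases nonempty_fintype ι
  suffices h : ∀ s : Finset ι, LineOpen (⋂ i ∈ s, A i) ∧ (⋂ i ∈ s, A i).Nonempty by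
    simpa using (h Finset.univ).2
  intro s
  induction s using Finset.induction_on with
  | empty => exact ⟨fun x _ u => by simp, ⟨0, by simp⟩⟩
  | insert a s _ ih =>
    rw [Finset.set_biInter_insert]
    exact ⟨(hA a).inter ih.1, (hA a).nonempty_inter ih.1 (hA' a) ih.2⟩

theorem LineOpen.iUnion {ι : Sort*} {A : ι → Set E} (hA : ∀ i, LineOpen (A i)) :
    LineOpen (⋃ i, A i) := by
  intro x hx u
  obtain ⟨i, hi⟩ := Set.mem_iUnion.1 hx
  refine (hA i x hi u).subset fun t ht h => ht ?_
  exact Set.mem_iUnion.2 ⟨i, h⟩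

theorem LineOpen.preimage {E' : Type*} [AddCommGroup E'] [Module ℂ E'] {A : Set E'}
    (hA : LineOpen A) (c : E') (l : E →ₗ[ℂ] E') : LineOpen ((fun x => c + l x) ⁻¹' A) := by
  intro x hx u
  refine (hA _ hx (l u)).subset fun t ht h => ht ?_
  simpa [add_assoc] using h

theorem LineOpen.eventually {A : Set E} (hA : LineOpen A) {x : E} (hx : x ∈ A) (y : E) :
    ∀ᶠ t in nhdsWithin (0 : ℂ) {0}ᶜ, y + t • (x - y) ∈ A := by
  have h := (hA x hx (y - x)).image (fun t => 1 - t)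
  -- The endpoint y, at t = 0, may lie outside A, so it is removed from the finite bad set before
  -- taking the complement.
  filter_upwards [self_mem_nhdsWithin, mem_nhdsWithin_of_mem_nhds
    ((h.subset (Set.sdiff_subset (t := {0}))).isClosed.compl_mem_nhds (by simp))] with t ht0 ht1
  have ht : t ∉ (fun t => 1 - t) '' {t : ℂ | x + t • (y - x) ∉ A} := fun h => ht1 ⟨h, ht0⟩
  by_contra h'
  refine ht ⟨1 - t, fun h => h' ?_, by ring⟩
  convert h using 1
  module

end LineOpen

/-! ### Ranks along lines -/

section Rank

variable {A B : Type*} [AddCommGroup A] [Module ℂ A] [AddCommGroup B] [Module ℂ B]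

/-- A left inverse of the coordinate map of u turns the moved family into the rows of 1 + tM, whose
determinant is a polynomial in t equal to 1 at t = 0. -/
theorem finite_not_linearIndependent_line {ι : Type*} [Finite ι] {u : ι → B}
    (hu : LinearIndependent ℂ u) (w : ι → B) :
    {t : ℂ | ¬ LinearIndependent ℂ (fun i => u i + t • w i)}.Finite := by
  classical
  cases nonempty_fintype ι
  obtain ⟨l, hl⟩ := (Fintype.linearCombination ℂ u).exists_leftInverse_of_injective
    (LinearMap.ker_eq_bot.2 (linearIndependent_iff_injective_fintypeLinearCombination.1 hu))
  have hlu : ∀ i, l (u i) = Pi.single i 1 := by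
    intro i
    have := LinearMap.congr_fun hl (Pi.single i 1)
    simpa [Fintype.linearCombination_apply_single] using this
  let M : Matrix ι ι ℂ := fun i j => l (w i) j
  let q : Polynomial ℂ := (1 + (Polynomial.X : Polynomial ℂ) • M.map Polynomial.C).det
  have hq : ∀ t, q.eval t = (1 + t • M).det := by
    intro t
    rw [← Polynomial.coe_evalRingHom, RingHom.map_det]
    congr 1
    ext i j
    by_cases hij : i = j <;> simp [hij, mul_comm t]
  have hq0 : q ≠ 0 := by
    intro h
    have := hq 0
    simp [h] at this
  refine (q.roots.toFinset.finite_toSet).subset fun t ht => ?_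
  simp only [Finset.mem_coe, Multiset.mem_toFinset, Polynomial.mem_roots hq0, Polynomial.IsRoot]
  by_contra hne
  rw [hq] at hne
  apply ht
  have h1 := Matrix.linearIndependent_rows_of_det_ne_zero hne
  refine LinearIndependent.of_comp l ?_
  have h2 : (l ∘ fun i => u i + t • w i) = fun i => (1 + t • M) i := by
    funext i j
    change l (u i + t • w i) j = (1 : Matrix ι ι ℂ) i j + t * l (w i) j
    simp [hlu, Matrix.one_apply, Pi.single_apply, eq_comm]
  rw [h2]
  exact h1

variable [FiniteDimensional ℂ B]

theorem le_finrank_range_iff {L : A →ₗ[ℂ] B} {r : ℕ} :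
    r ≤ finrank ℂ (LinearMap.range L) ↔ ∃ a : Fin r → A, LinearIndependent ℂ fun i => L (a i) := by
  constructor
  · intro h
    have b := finBasis ℂ (LinearMap.range L)
    choose a ha using fun i => (b i).2
    refine ⟨fun i => a (Fin.castLE h i), ?_⟩
    have h1 : LinearIndependent ℂ fun i => ((b i : LinearMap.range L) : B) :=
      b.linearIndependent.map' (LinearMap.range L).subtype (Submodule.ker_subtype _)
    have h2 := h1.comp _ (Fin.castLE_injective h)
    convert h2 using 1
    funext i
    exact ha _
  · rintro ⟨a, ha⟩
    have h1 : LinearIndependent ℂ fun i => (⟨L (a i), a i, rfl⟩ : LinearMap.range L) :=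
      LinearIndependent.of_comp (LinearMap.range L).subtype ha
    simpa using h1.fintype_card_le_finrank

theorem lineOpen_le_finrank_range {E : Type*} [AddCommGroup E] [Module ℂ E]
    (D : E →ₗ[ℂ] A →ₗ[ℂ] B) (r : ℕ) :
    LineOpen {x | r ≤ finrank ℂ (LinearMap.range (D x))} := by
  intro x hx u
  obtain ⟨a, ha⟩ := le_finrank_range_iff.1 hx
  refine (finite_not_linearIndependent_line ha fun i => D u (a i)).subset fun t ht h => ht ?_
  refine le_finrank_range_iff.2 ⟨a, ?_⟩
  simpa using h

/-- If the rank does not grow along the line `L + t L'`, then `L'` maps the kernel of `L` into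
the range of `L`. -/
theorem mem_range_of_finrank_range_le {L L' : A →ₗ[ℂ] B}
    (h : ∀ t : ℂ, finrank ℂ (LinearMap.range (L + t • L')) ≤ finrank ℂ (LinearMap.range L))
    {x : A} (hx : L x = 0) : L' x ∈ LinearMap.range L := by
  by_contra hcon
  obtain ⟨a, ha⟩ := le_finrank_range_iff.1 (le_refl (finrank ℂ (LinearMap.range L)))
  have hu : LinearIndependent ℂ (Fin.cons (L' x) fun i => L (a i) :
      Fin (finrank ℂ (LinearMap.range L) + 1) → B) := by
    rw [linearIndependent_finCons]
    refine ⟨ha, fun h' => hcon ?_⟩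
    refine Submodule.span_le.2 ?_ h'
    rintro _ ⟨i, rfl⟩
    exact ⟨a i, rfl⟩
  have hfin := finite_not_linearIndependent_line hu (Fin.cons 0 fun i => L' (a i))
  obtain ⟨t, ht⟩ := (hfin.union (Set.finite_singleton 0)).infinite_compl.nonempty
  simp only [Set.mem_compl_iff, Set.mem_union, Set.mem_ofPred_eq, not_or, not_not,
    Set.mem_singleton_iff] at ht
  obtain ⟨ht, ht0⟩ := ht
  have h1 : finrank ℂ (LinearMap.range L) + 1 ≤ finrank ℂ (LinearMap.range (L + t • L')) := by
    -- Since L x = 0, the map L + tL' sends t⁻¹x exactly to L'x, giving one more independent vector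
    -- than the rank of L.
    refine le_finrank_range_iff.2 ⟨Fin.cons (t⁻¹ • x) a, ?_⟩
    convert ht using 1
    funext i
    refine Fin.cases ?_ (fun i => ?_) i
    · simp [hx, smul_smul, ht0]
    · simp
  have := h t
  omega

end Rank

end FilteredQuiver

namespace FilteredQuiver

open Module

/-! ### Filtered linear maps -/

section Single

variable {V : Type*} [AddCommGroup V] [Module ℂ V] {W : Type*} [AddCommGroup W] [Module ℂ W]

/-- Linear maps compatible with two filtrations. -/
def filHom (F : Filtration V) (G : Filtration W) : Submodule ℂ (V →ₗ[ℂ] W) where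
  carrier := {φ | ∀ i, ∀ z ∈ F i, φ z ∈ G i}
  zero_mem' := fun i _ _ => (G i).zero_mem
  add_mem' := fun hφ hψ i z hz => (G i).add_mem (hφ i z hz) (hψ i z hz)
  smul_mem' := fun c _ hφ i z hz => (G i).smul_mem c (hφ i z hz)

variable [FiniteDimensional ℂ V]

theorem Filtration.succ_le_sup_span (F : Filtration V) {k : ℕ} {s : V} (hs : s ∈ F (k + 1))
    (hs' : s ∉ F k) : F (k + 1) ≤ F k ⊔ Submodule.span ℂ {s} := by
  have h1 : F k ⊔ Submodule.span ℂ {s} ≤ F (k + 1) :=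
    sup_le (F.monotone (Nat.le_succ k)) (by simpa using hs)
  have h2 : F k < F k ⊔ Submodule.span ℂ {s} := by
    refine lt_of_le_of_ne le_sup_left fun h => hs' ?_
    rw [h]
    exact Submodule.mem_sup_right (Submodule.mem_span_singleton_self s)
  have h3 := Submodule.finrank_lt_finrank_of_lt h2
  have h4 := F.finrank_succ_le k
  exact (Submodule.eq_of_le_of_finrank_le h1 (by omega)).ge

open Classical in
theorem Filtration.finrank_succ_sub (F : Filtration V) (i : ℕ) :
    (finrank ℂ (F (i + 1)) : ℤ) - finrank ℂ (F i) = if F i ≠ F (i + 1) then 1 else 0 := by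
  split_ifs with h
  · have h2 := Submodule.finrank_lt_finrank_of_lt (lt_of_le_of_ne (F.monotone (Nat.le_succ i)) h)
    have h3 := F.finrank_succ_le i
    simp only [Nat.succ_eq_add_one] at h2
    omega
  · rw [not_not] at h
    rw [← h, sub_self]

/-- One vector is chosen at each jump F i ≠ F (i + 1); as jumps have size one, this gives a basis
adapted to the filtration. -/
theorem Filtration.exists_basis (F : Filtration V) {L : ℕ} (hL : F L = ⊤) :
    ∃ b : Basis {i : Fin L // F i ≠ F (i + 1)} ℂ V,
      (∀ j : {i : Fin L // F i ≠ F (i + 1)}, b j ∈ F (j + 1)) ∧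
      ∀ m ≤ L, F m ≤ Submodule.span ℂ (b '' {j | (j : ℕ) < m}) := by
  classical
  have hex : ∀ j : {i : Fin L // F i ≠ F (i + 1)}, ∃ z, z ∈ F (j + 1) ∧ z ∉ F j := fun j =>
    SetLike.exists_of_lt (lt_of_le_of_ne (F.monotone (Nat.le_succ _)) j.2)
  choose c hc hc' using hex
  have hspan : ∀ m ≤ L, F m ≤ Submodule.span ℂ (c '' {j | (j : ℕ) < m}) := by
    intro m
    induction m with
    | zero => intro _; rw [F.zero_eq_bot]; exact bot_le
    | succ m ih =>
      intro hm
      have ih' := (ih (by omega)).trans (Submodule.span_mono (Set.image_mono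
        (fun j (hj : (j : ℕ) < m) => (by omega : (j : ℕ) < m + 1)) :
        c '' {j | (j : ℕ) < m} ⊆ c '' {j | (j : ℕ) < m + 1}))
      by_cases h : F m = F (m + 1)
      · rw [← h]
        exact ih'
      · let j : {i : Fin L // F i ≠ F (i + 1)} := ⟨⟨m, by omega⟩, h⟩
        refine (F.succ_le_sup_span (hc j) (hc' j)).trans (sup_le ih' ?_)
        rw [Submodule.span_singleton_le_iff_mem]
        exact Submodule.subset_span ⟨j, by simp [j], rfl⟩
  have hcard : Fintype.card {i : Fin L // F i ≠ F (i + 1)} = finrank ℂ V := by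
    have h2 := Finset.sum_range_sub (fun i => (finrank ℂ (F i) : ℤ)) L
    rw [hL, F.zero_eq_bot, finrank_bot, finrank_top, Finset.sum_congr rfl fun i _ => F.finrank_succ_sub i,
      Finset.sum_range fun i => if F i ≠ F (i + 1) then (1 : ℤ) else 0, Finset.sum_boole] at h2
    rw [Fintype.card_subtype]
    exact_mod_cast by simpa using h2
  have htop : ⊤ ≤ Submodule.span ℂ (Set.range c) := by
    rw [← hL]
    exact (hspan L le_rfl).trans (Submodule.span_mono (Set.image_subset_range _ _))
  refine ⟨basisOfTopLeSpanOfCardEqFinrank c htop hcard, ?_, ?_⟩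
  · simpa using hc
  · simpa using hspan

/-- A filtered map is a free choice of images for an adapted basis: the vector of the jump from i to
i + 1 goes anywhere in G (i + 1). -/
theorem finrank_filHom [FiniteDimensional ℂ W] (F : Filtration V) (G : Filtration W) {L : ℕ}
    (hL : F L = ⊤) :
    (finrank ℂ (filHom F G) : ℤ) = ∑ i ∈ Finset.range L,
      ((finrank ℂ (F (i + 1)) : ℤ) - finrank ℂ (F i)) * finrank ℂ (G (i + 1)) := by
  classical
  obtain ⟨b, hb, hspan⟩ := F.exists_basis hL
  let ev : filHom F G →ₗ[ℂ] ∀ j : {i : Fin L // F i ≠ F (i + 1)}, G (j + 1) :=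
    LinearMap.pi fun j => LinearMap.codRestrict _
      ((LinearMap.applyₗ (b j)).comp (filHom F G).subtype) fun φ => φ.2 _ _ (hb j)
  have hev : Function.Bijective ev := by
    constructor
    · intro φ ψ h
      refine Subtype.ext (b.ext fun j => ?_)
      exact congrArg Subtype.val (congrFun h j)
    · intro g
      have key : ∀ m ≤ L, ∀ z ∈ F m, b.constr ℂ (fun j => (g j : W)) z ∈ G m := by
        intro m hm z hz
        refine (Submodule.span_le (p := (G m).comap (b.constr ℂ fun j => (g j : W)))).2 ?_
          (hspan m hm hz)
        rintro _ ⟨j, hj, rfl⟩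
        simp only [Submodule.comap_coe, Set.mem_preimage, Basis.constr_basis, SetLike.mem_coe]
        exact G.monotone (show (j : ℕ) + 1 ≤ m from hj) (g j).2
      refine ⟨⟨b.constr ℂ fun j => (g j : W), fun i z hz => ?_⟩, ?_⟩
      · rcases le_total i L with h | h
        · exact key i h z hz
        · exact G.monotone h (key L le_rfl z (by rw [hL]; trivial))
      · funext j
        refine Subtype.ext ?_
        change b.constr ℂ (fun j => (g j : W)) (b j) = g j
        rw [Basis.constr_basis]
  rw [(LinearEquiv.ofBijective ev hev).finrank_eq, Module.finrank_pi_fintype, Nat.cast_sum,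
    Finset.sum_range fun i => ((finrank ℂ (F (i + 1)) : ℤ) - finrank ℂ (F i)) *
      (finrank ℂ (G (i + 1)) : ℤ)]
  simp only [F.finrank_succ_sub, ite_mul, one_mul, zero_mul]
  rw [← Finset.sum_filter]
  exact (Finset.sum_subtype (Finset.univ.filter fun i : Fin L => F i ≠ F (i + 1)) (by simp)
    fun i : Fin L => (finrank ℂ (G (i + 1)) : ℤ)).symm

/-- Every subspace has a projection compatible with the filtration. -/
theorem Filtration.exists_retraction (F : Filtration V) (S : Submodule ℂ V) :
    ∃ π : V →ₗ[ℂ] S, (∀ s : S, π s = s) ∧ ∀ i, ∀ z ∈ F i, (π z : V) ∈ F i := by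
  -- A complement of S adapted to the filtration is built level by level, adding a vector only when
  -- F (m + 1) is not yet covered by S + C.
  have key : ∀ m, ∃ C : Submodule ℂ V, C ≤ F m ∧ Disjoint S C ∧ ∀ i ≤ m, F i ≤ S ⊔ (F i ⊓ C) := by
    intro m
    induction m with
    | zero =>
      refine ⟨⊥, bot_le, disjoint_bot_right, fun i hi => ?_⟩
      rw [Nat.le_zero.1 hi, F.zero_eq_bot]
      exact bot_le
    | succ m ih =>
      obtain ⟨C, hC, hd, hF⟩ := ih
      have hmm := F.monotone (Nat.le_succ m)
      by_cases h : F (m + 1) ≤ S ⊔ C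
      · refine ⟨C, hC.trans hmm, hd, fun i hi => ?_⟩
        rcases Nat.le_succ_iff.1 hi with hi | rfl
        · exact hF i hi
        · rwa [inf_eq_right.2 (hC.trans hmm)]
      · obtain ⟨z, hz, hz'⟩ := SetLike.not_le_iff_exists.1 h
        have hzm : z ∉ F m := fun h' =>
          hz' (((hF m le_rfl).trans (sup_le_sup_left inf_le_right S)) h')
        refine ⟨C ⊔ Submodule.span ℂ {z}, sup_le (hC.trans hmm) (by simpa using hz), ?_, ?_⟩
        · rw [Submodule.disjoint_def]
          intro x hxS hx
          obtain ⟨c, hc, w, hw, rfl⟩ := Submodule.mem_sup.1 hx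
          obtain ⟨t, rfl⟩ := Submodule.mem_span_singleton.1 hw
          by_cases ht : t = 0
          · subst ht
            rw [zero_smul, add_zero] at hxS ⊢
            exact (Submodule.disjoint_def.1 hd) c hxS hc
          · exfalso
            apply hz'
            have : t • z ∈ S ⊔ C := by
              have := Submodule.sub_mem _ (Submodule.mem_sup_left (T := C) hxS)
                (Submodule.mem_sup_right (S := S) hc)
              simpa using this
            exact (Submodule.smul_mem_iff _ ht).1 this
        · intro i hi
          rcases Nat.le_succ_iff.1 hi with hi | rfl
          · exact (hF i hi).trans (sup_le_sup_left (inf_le_inf_left _ le_sup_left) S)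
          · have h1 : C ⊔ Submodule.span ℂ {z} ≤ F (m + 1) :=
              sup_le (hC.trans hmm) (by simpa using hz)
            rw [Nat.succ_eq_add_one, inf_eq_right.2 h1, ← sup_assoc]
            refine (F.succ_le_sup_span hz hzm).trans (sup_le_sup_right ?_ _)
            exact (hF m le_rfl).trans (sup_le_sup_left inf_le_right S)
  obtain ⟨L, hL⟩ := F.exists_eq_top
  obtain ⟨C, -, hd, hF⟩ := key L
  have hc : IsCompl S C := by
    refine ⟨hd, codisjoint_iff_le_sup.2 ?_⟩
    rw [← hL]
    exact (hF L le_rfl).trans (sup_le_sup_left inf_le_right S)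
  refine ⟨S.projectionOnto C hc, fun s => Submodule.projectionOnto_apply_left hc s,
    fun i z hz => ?_⟩
  rcases le_total i L with hi | hi
  · obtain ⟨s, hs, c, ⟨hcF, hcC⟩, rfl⟩ := Submodule.mem_sup.1 (hF i hi hz)
    have h1 := Submodule.projectionOnto_apply_left hc ⟨s, hs⟩
    have h2 := Submodule.projectionOnto_apply_right hc ⟨c, hcC⟩
    simp only at h1 h2
    rw [map_add, h1, h2, add_zero]
    simpa using Submodule.sub_mem _ hz hcF
  · have : F i = ⊤ := top_le_iff.1 (hL ▸ F.monotone hi)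
    rw [this]
    trivial

/-- The filtered endomorphisms `n` with `n = n π` and `π n = 0`, for a projection `π` onto `S`:
the tangent space of the Schubert cell of `S`. -/
def nilHom (F : Filtration V) {S : Submodule ℂ V} (π : V →ₗ[ℂ] S) : Submodule ℂ (V →ₗ[ℂ] V) where
  carrier := {n | n ∈ filHom F F ∧ (∀ z, π (n z) = 0) ∧ ∀ z, n (π z) = n z}
  zero_mem' := ⟨Submodule.zero_mem _, fun _ => by simp, fun _ => by simp⟩
  add_mem' := fun h h' => ⟨Submodule.add_mem _ h.1 h'.1, fun z => by simp [h.2.1, h'.2.1],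
    fun z => by simp [h.2.2, h'.2.2]⟩
  smul_mem' := fun c _ h => ⟨Submodule.smul_mem _ c h.1, fun z => by simp [h.2.1],
    fun z => by simp [h.2.2]⟩

section nilHom

variable {F : Filtration V} {S : Submodule ℂ V} {π : V →ₗ[ℂ] S}

omit [FiniteDimensional ℂ V] in
theorem nilHom_apply_apply {n : V →ₗ[ℂ] V} (hn : n ∈ nilHom F π) (z : V) : n (n z) = 0 := by
  rw [← hn.2.2, hn.2.1]
  simp

omit [FiniteDimensional ℂ V] in
-- The image of S under 1 + n is the graph of n over S, and π recovers the base point of each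
-- element of the graph.
theorem nilHom_eq_of_map_eq (hπ : ∀ s : S, π s = s) {n n' : V →ₗ[ℂ] V} (hn : n ∈ nilHom F π)
    (hn' : n' ∈ nilHom F π)
    (h : S.map (LinearMap.id + n) = S.map (LinearMap.id + n')) : n = n' := by
  ext z
  rw [← hn.2.2, ← hn'.2.2]
  have : (LinearMap.id + n : V →ₗ[ℂ] V) (π z : V) ∈ S.map (LinearMap.id + n') := by
    rw [← h]
    exact Submodule.mem_map_of_mem (π z).2
  obtain ⟨s, hs, hs'⟩ := this
  have h1 := congrArg π hs'
  simp only [LinearMap.add_apply, LinearMap.id_apply, map_add, hn.2.1, hn'.2.1, hπ, add_zero] at h1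
  rw [hπ ⟨s, hs⟩] at h1
  rw [show s = (π z : V) from congrArg Subtype.val h1] at hs'
  simp only [LinearMap.add_apply, LinearMap.id_apply, add_right_inj] at hs'
  exact hs'.symm

/-- The unipotent automorphism `1 + n`. -/
def unipotent (n : V →ₗ[ℂ] V) (hn : ∀ z, n (n z) = 0) : V ≃ₗ[ℂ] V :=
  LinearEquiv.ofLinearMap (LinearMap.id + n) (LinearMap.id - n) (by ext z; simp [hn])
    (by ext z; simp [hn])

/-- Two subspaces in the same position with respect to a filtration differ by a unipotent
automorphism. -/
theorem exists_nilHom_map_eq (hπ : ∀ s : S, π s = s) (hπF : ∀ i, ∀ z ∈ F i, (π z : V) ∈ F i)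
    {N : Submodule ℂ V}
    (h : ∀ i, finrank ℂ (F i ⊓ N : Submodule ℂ V) = finrank ℂ (F i ⊓ S : Submodule ℂ V)) :
    ∃ n ∈ nilHom F π, N = S.map (LinearMap.id + n) := by
  obtain ⟨L, hL⟩ := F.exists_eq_top
  have hker : ∀ i, ∀ z ∈ F i, z ∈ N → π z = 0 → z = 0 := by
    intro i
    induction i with
    | zero => intro z hz _ _; simpa [F.zero_eq_bot] using hz
    | succ k ih =>
      intro z hz hzN hπz
      by_cases hzk : z ∈ F k
      · exact ih z hzk hzN hπz
      exfalso
      -- Injectivity of π on N: a jump of N at this level forces a jump of S there, so z = f + cs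
      -- with f in F k and s in S. Then πz = 0 gives z = f - πf, which already lies in F k.
      have h1 : F k ⊓ N < F (k + 1) ⊓ N :=
        lt_of_le_of_ne (inf_le_inf_right _ (F.monotone (Nat.le_succ k)))
          fun h' => hzk ((h'.symm ▸ ⟨hz, hzN⟩ : z ∈ F k ⊓ N)).1
      have h2 := Submodule.finrank_lt_finrank_of_lt h1
      rw [h, h] at h2
      have h3 : ∃ s ∈ S, s ∈ F (k + 1) ∧ s ∉ F k := by
        by_contra! hcon
        refine h2.not_ge (Submodule.finrank_mono fun s hs => ⟨hcon s hs.2 hs.1, hs.2⟩)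
      obtain ⟨s, hsS, hs, hs'⟩ := h3
      obtain ⟨f, hf, w, hw, hfw⟩ := Submodule.mem_sup.1 (F.succ_le_sup_span hs hs' hz)
      obtain ⟨c, rfl⟩ := Submodule.mem_span_singleton.1 hw
      apply hzk
      have h4 : (π (f + c • s) : V) = π f + c • s := by
        rw [map_add, map_smul, hπ ⟨s, hsS⟩]
        rfl
      rw [hfw, hπz] at h4
      have h5 : z = f - π f := by
        rw [← hfw, sub_eq_add_neg, add_right_inj, eq_neg_iff_add_eq_zero, add_comm]
        exact h4.symm
      rw [h5]
      exact Submodule.sub_mem _ hf (hπF k f hf)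
  have hker' : ∀ z ∈ N, π z = 0 → z = 0 := fun z => hker L z (by rw [hL]; trivial)
  have hNS : finrank ℂ N = finrank ℂ S := by
    have := h L
    rwa [hL, top_inf_eq, top_inf_eq] at this
  let p : N →ₗ[ℂ] S := π.domRestrict N
  have hp : Function.Injective p := by
    rw [← LinearMap.ker_eq_bot, LinearMap.ker_eq_bot']
    rintro ⟨z, hz⟩ h0
    exact Subtype.ext (hker' z hz h0)
  let e : N ≃ₗ[ℂ] S := LinearEquiv.ofInjectiveOfFinrankEq p hp hNS
  have he : ∀ z : N, e z = π z := fun z => rfl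
  -- The inverse of π on N is filtered too: π embeds F i ∩ N in F i ∩ S, and the dimensions agree.
  have heF : ∀ i, ∀ s : S, (s : V) ∈ F i → (e.symm s : V) ∈ F i := by
    intro i s hs
    have h1 : (F i ⊓ N).map ((Submodule.subtype S).comp π) = F i ⊓ S := by
      refine Submodule.eq_of_le_of_finrank_le ?_ ?_
      · rintro _ ⟨z, hz, rfl⟩
        exact ⟨hπF i z hz.1, (π z).2⟩
      · have hinj : Function.Injective (((Submodule.subtype S).comp π).domRestrict (F i ⊓ N)) := by
          rw [← LinearMap.ker_eq_bot, LinearMap.ker_eq_bot']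
          rintro ⟨z, hz⟩ h0
          exact Subtype.ext (hker' z hz.2 (Subtype.ext h0))
        rw [← h, ← LinearMap.finrank_range_of_inj hinj, LinearMap.domRestrict,
          LinearMap.range_comp, Submodule.range_subtype]
    have h2 : (s : V) ∈ (F i ⊓ N).map ((Submodule.subtype S).comp π) := by
      rw [h1]; exact ⟨hs, s.2⟩
    obtain ⟨z, hz, hzs⟩ := h2
    have h3 : e ⟨z, hz.2⟩ = s := Subtype.ext hzs
    rw [← h3, LinearEquiv.symm_apply_apply]
    exact hz.1
  have heπ : ∀ s, π (e.symm s : V) = s := fun s => by rw [← he, LinearEquiv.apply_symm_apply]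
  let n : V →ₗ[ℂ] V := N.subtype ∘ₗ e.symm.toLinearMap ∘ₗ π - S.subtype ∘ₗ π
  have hn : ∀ z, n z = (e.symm (π z) : V) - π z := fun z => rfl
  refine ⟨n, ⟨fun i z hz => ?_, fun z => ?_, fun z => ?_⟩, ?_⟩
  · rw [hn]
    exact Submodule.sub_mem _ (heF i _ (hπF i z hz)) (hπF i z hz)
  · rw [hn, map_sub, heπ, hπ, sub_self]
  · rw [hn, hn, hπ]
  · ext z
    constructor
    · intro hz
      refine ⟨e ⟨z, hz⟩, (e ⟨z, hz⟩).2, ?_⟩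
      rw [LinearMap.add_apply, hn, hπ]
      simp
    · rintro ⟨s, hs, rfl⟩
      rw [LinearMap.add_apply, hn, hπ ⟨s, hs⟩]
      simp

end nilHom

end Single

end FilteredQuiver

namespace FilteredQuiver

open Module

set_option linter.unusedSectionVars false

universe u₀ u₁ u₂ u₃

/-! ### Positions of subfamilies -/

section Position

variable {Q₀ : Type u₀} {V : Q₀ → Type u₂} [∀ x, AddCommGroup (V x)] [∀ x, Module ℂ (V x)]

theorem Filtration.exists_common_top [Finite Q₀] (F : ∀ x, Filtration (V x)) :
    ∃ L, ∀ x, F x L = ⊤ := by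
  choose l hl using fun x => (F x).exists_eq_top
  obtain ⟨L, hL⟩ := (Set.finite_range l).bddAbove
  exact ⟨L, fun x => top_le_iff.1 (hl x ▸ (F x).monotone (hL ⟨x, rfl⟩))⟩

/-- The position of a family of subspaces relative to the filtrations. -/
noncomputable def position (F : ∀ x, Filtration (V x)) (N : ∀ x, Submodule ℂ (V x)) (x : Q₀) (i : ℕ) : ℕ :=
  finrank ℂ (F x i ⊓ N x : Submodule ℂ (V x))

theorem position_of_eq_top {F : ∀ x, Filtration (V x)} {x : Q₀} {i : ℕ} (h : F x i = ⊤)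
    (N : ∀ x, Submodule ℂ (V x)) : position F N x i = finrank ℂ (N x) := by
  rw [position, h, top_inf_eq]

end Position

/-! ### Euler numbers of subfamilies -/

section Euler

variable {Q₀ : Type u₀} [Quiver.{u₁} Q₀] [Fintype Q₀] [∀ x y : Q₀, Finite (x ⟶ y)]
variable {V : Q₀ → Type u₂} [∀ x, AddCommGroup (V x)] [∀ x, Module ℂ (V x)]
  [∀ x, FiniteDimensional ℂ (V x)]
variable {W : Q₀ → Type u₃} [∀ x, AddCommGroup (W x)] [∀ x, Module ℂ (W x)]
  [∀ x, FiniteDimensional ℂ (W x)]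

variable (W) in
/-- The total dimension of the targets of the arrows that start at `x`. -/
noncomputable def outDim (x : Q₀) : ℕ := ∑ y, Nat.card (x ⟶ y) * finrank ℂ (W y)

theorem finrank_HQ : finrank ℂ (HQ V W) = ∑ x, finrank ℂ (V x) * outDim W x := by
  classical
  have : ∀ x y : Q₀, Fintype (x ⟶ y) := fun x y => Fintype.ofFinite _
  simp only [Module.finrank_pi_fintype, finrank_linearMap, outDim, Finset.mul_sum,
    Finset.sum_const, smul_eq_mul, Nat.card_eq_fintype_card, Finset.card_univ]
  refine Finset.sum_congr rfl fun x _ => Finset.sum_congr rfl fun y _ => by ring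

theorem finrank_gQFil (F : ∀ x, Filtration (V x)) (G : ∀ x, Filtration (W x)) :
    finrank ℂ (gQFil F G) = ∑ x, finrank ℂ (filHom (F x) (G x)) := by
  classical
  rw [← Module.finrank_pi_fintype]
  exact LinearEquiv.finrank_eq
    { toFun := fun φ x => ⟨φ.1 x, φ.2 x⟩
      invFun := fun φ => ⟨fun x => (φ x).1, fun x => (φ x).2⟩
      map_add' := fun _ _ => rfl
      map_smul' := fun _ _ => rfl
      left_inv := fun _ => rfl
      right_inv := fun _ => rfl }

/-- The Euler number as a function of the dimensions `d x i = dim F x i`. -/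
noncomputable def eulOf (G : ∀ x, Filtration (W x)) (L : ℕ) (d : Q₀ → ℕ → ℕ) : ℤ :=
  ∑ x, ((d x L : ℤ) * ((finrank ℂ (G x L) : ℤ) - outDim W x) - ∑ i ∈ Finset.range L,
    (d x i : ℤ) * ((finrank ℂ (G x (i + 1)) : ℤ) - finrank ℂ (G x i)))

theorem eul_eq_eulOf (F : ∀ x, Filtration (V x)) (G : ∀ x, Filtration (W x)) {L : ℕ}
    (hL : ∀ x, F x L = ⊤) : eul F G = eulOf G L fun x i => finrank ℂ (F x i) := by
  rw [eul, finrank_gQFil, finrank_HQ, Nat.cast_sum, Nat.cast_sum, ← Finset.sum_sub_distrib, eulOf]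
  refine Finset.sum_congr rfl fun x _ => ?_
  -- Summation by parts; the boundary term at 0 vanishes because F 0 = 0.
  have abel : ∀ m : ℕ, ∑ i ∈ Finset.range m,
      ((finrank ℂ (F x (i + 1)) : ℤ) - finrank ℂ (F x i)) * finrank ℂ (G x (i + 1))
      = (finrank ℂ (F x m) : ℤ) * finrank ℂ (G x m) - ∑ i ∈ Finset.range m,
        (finrank ℂ (F x i) : ℤ) * ((finrank ℂ (G x (i + 1)) : ℤ) - finrank ℂ (G x i)) := by
    intro m
    induction m with
    | zero => simp [(F x).zero_eq_bot]
    | succ m ih => rw [Finset.sum_range_succ, Finset.sum_range_succ, ih]; ring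
  rw [finrank_filHom (F x) (G x) (hL x), abel, hL x, finrank_top]
  push_cast
  ring

/-- The Euler number `eul(𝒩, 𝒲)` of a family of subspaces with the inherited filtrations. -/
noncomputable def subEul (F : ∀ x, Filtration (V x)) (G : ∀ x, Filtration (W x)) (N : ∀ x, Submodule ℂ (V x)) :
    ℤ :=
  eul (fun x => (F x).sub (N x)) G

theorem subEul_eq_eulOf (F : ∀ x, Filtration (V x)) (G : ∀ x, Filtration (W x)) {L : ℕ}
    (hL : ∀ x, F x L = ⊤) (N : ∀ x, Submodule ℂ (V x)) :
    subEul F G N = eulOf G L (position F N) := by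
  rw [subEul, eul_eq_eulOf (L := L) _ G fun x => by
    change (F x L).comap _ = ⊤
    rw [hL, Submodule.comap_top]]
  congr 1
  funext x i
  exact finrank_comap_subtype_eq (N x) (F x i)

theorem subEul_top (F : ∀ x, Filtration (V x)) (G : ∀ x, Filtration (W x)) :
    subEul F G (fun _ => ⊤) = eul F G := by
  obtain ⟨L, hL⟩ := Filtration.exists_common_top F
  rw [subEul_eq_eulOf F G hL, eul_eq_eulOf F G hL]
  congr 1
  funext x i
  rw [position, inf_top_eq]

/-- The dimensions d x i enter with coefficients -(dim G (i + 1) - dim G i) ≤ 0, apart from the top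
one, which is held fixed. More special positions therefore have smaller Euler numbers. -/
theorem eulOf_mono (G : ∀ x, Filtration (W x)) {L : ℕ} {d d' : Q₀ → ℕ → ℕ}
    (h : ∀ x i, d x i ≤ d' x i) (hL : ∀ x, d x L = d' x L) : eulOf G L d' ≤ eulOf G L d := by
  refine Finset.sum_le_sum fun x _ => ?_
  rw [hL]
  refine sub_le_sub_left (Finset.sum_le_sum fun i _ => ?_) _
  refine mul_le_mul_of_nonneg_right (by exact_mod_cast h x i) ?_
  have := Submodule.finrank_mono ((G x).monotone (Nat.le_succ i))
  simp only [Nat.succ_eq_add_one] at this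
  omega

theorem subEul_le_of_position_le (F : ∀ x, Filtration (V x)) (G : ∀ x, Filtration (W x))
    {N S : ∀ x, Submodule ℂ (V x)} (h : ∀ x i, position F S x i ≤ position F N x i)
    (hd : ∀ x, finrank ℂ (N x) = finrank ℂ (S x)) : subEul F G N ≤ subEul F G S := by
  obtain ⟨L, hL⟩ := Filtration.exists_common_top F
  rw [subEul_eq_eulOf F G hL, subEul_eq_eulOf F G hL]
  refine eulOf_mono G h fun x => ?_
  rw [position_of_eq_top (hL x), position_of_eq_top (hL x), hd]

/-- Submodularity: F(i)∩N + F(i)∩N' lies in F(i)∩(N+N'), so the summed dimensions of sup and inf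
dominate those of N and N', with equality at the top level. -/
theorem subEul_sup_add_inf_le (F : ∀ x, Filtration (V x)) (G : ∀ x, Filtration (W x))
    (N N' : ∀ x, Submodule ℂ (V x)) :
    subEul F G (N ⊔ N') + subEul F G (N ⊓ N') ≤ subEul F G N + subEul F G N' := by
  obtain ⟨L, hL⟩ := Filtration.exists_common_top F
  have hadd : ∀ d d' : Q₀ → ℕ → ℕ, eulOf G L d + eulOf G L d'
      = eulOf G L fun x i => d x i + d' x i := by
    intro d d'
    simp only [eulOf]
    rw [← Finset.sum_add_distrib]
    refine Finset.sum_congr rfl fun x _ => ?_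
    simp only [Nat.cast_add, add_mul, Finset.sum_add_distrib]
    ring
  simp only [subEul_eq_eulOf F G hL, hadd]
  refine eulOf_mono G (fun x i => ?_) fun x => ?_
  · have h1 := Submodule.finrank_sup_add_finrank_inf_eq (F x i ⊓ N x) (F x i ⊓ N' x)
    have h2 : (F x i ⊓ N x) ⊔ (F x i ⊓ N' x) ≤ F x i ⊓ (N x ⊔ N' x) :=
      sup_le (inf_le_inf_left _ le_sup_left) (inf_le_inf_left _ le_sup_right)
    have h3 := Submodule.finrank_mono h2
    have h4 : (F x i ⊓ N x) ⊓ (F x i ⊓ N' x) = F x i ⊓ (N x ⊓ N' x) :=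
      (inf_inf_distrib_left _ _ _).symm
    rw [h4] at h1
    simp only [position, Pi.sup_apply, Pi.inf_apply]
    omega
  · simp only [position_of_eq_top (hL x), Pi.sup_apply, Pi.inf_apply]
    exact (Submodule.finrank_sup_add_finrank_inf_eq (N x) (N' x)).symm

theorem subEul_map_subtype (F : ∀ x, Filtration (V x)) (G : ∀ x, Filtration (W x))
    (S : ∀ x, Submodule ℂ (V x)) (N : ∀ x, Submodule ℂ (S x)) :
    subEul F G (fun x => (N x).map (S x).subtype) = subEul (fun x => (F x).sub (S x)) G N := by
  obtain ⟨L, hL⟩ := Filtration.exists_common_top F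
  rw [subEul_eq_eulOf F G hL, subEul_eq_eulOf (L := L) _ G fun x => by
    change (F x L).comap _ = ⊤
    rw [hL, Submodule.comap_top]]
  congr 1
  funext x i
  change finrank ℂ (F x i ⊓ (N x).map (S x).subtype : Submodule ℂ (V x))
    = finrank ℂ ((F x i).comap (S x).subtype ⊓ N x : Submodule ℂ (S x))
  rw [← Submodule.finrank_map_subtype_eq (S x) ((F x i).comap (S x).subtype ⊓ N x)]
  refine congrArg (fun A : Submodule ℂ (V x) => finrank ℂ A) ?_
  rw [Submodule.map_inf _ (S x).injective_subtype, Submodule.map_comap_subtype, inf_comm (S x),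
    inf_assoc, inf_eq_right.2 (Submodule.map_subtype_le (S x) (N x))]

theorem le_subEul (F : ∀ x, Filtration (V x)) (G : ∀ x, Filtration (W x))
    (N : ∀ x, Submodule ℂ (V x)) : -(finrank ℂ (HQ V W) : ℤ) ≤ subEul F G N := by
  rw [subEul, eul]
  have : finrank ℂ (HQ (fun x => N x) W) ≤ finrank ℂ (HQ V W) := by
    rw [finrank_HQ, finrank_HQ]
    exact Finset.sum_le_sum fun x _ => Nat.mul_le_mul_right _ (Submodule.finrank_le _)
  omega

end Euler

/-! ### The incidence of representations and subrepresentations -/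

section Incidence

variable {Q₀ : Type u₀} [Quiver.{u₁} Q₀]
variable {V : Q₀ → Type u₂} [∀ x, AddCommGroup (V x)] [∀ x, Module ℂ (V x)]
variable {F : ∀ x, Filtration (V x)} {S : ∀ x, Submodule ℂ (V x)}

variable (S) in
/-- The representations for which the family `S` is a subrepresentation. -/
def stabilizing : Submodule ℂ (HQ V V) where
  carrier := {v | IsSubrep v S}
  zero_mem' := fun x y a => by
    rintro _ ⟨z, -, rfl⟩
    exact (S y).zero_mem
  add_mem' := fun h h' x y a => by
    rintro _ ⟨z, hz, rfl⟩
    exact (S y).add_mem (h x y a ⟨z, hz, rfl⟩) (h' x y a ⟨z, hz, rfl⟩)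
  smul_mem' := fun c _ h x y a => by
    rintro _ ⟨z, hz, rfl⟩
    exact (S y).smul_mem c (h x y a ⟨z, hz, rfl⟩)

theorem IsSubrep.apply_mem {v : HQ V V} (h : IsSubrep v S) {x y : Q₀} (a : x ⟶ y) {z : V x}
    (hz : z ∈ S x) : v x y a z ∈ S y :=
  h x y a ⟨z, hz, rfl⟩

theorem IsSubrep.sup {v : HQ V V} {N N' : ∀ x, Submodule ℂ (V x)} (h : IsSubrep v N)
    (h' : IsSubrep v N') : IsSubrep v (N ⊔ N') := fun x y a => by
  rw [Pi.sup_apply, Submodule.map_sup]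
  exact sup_le_sup (h x y a) (h' x y a)

theorem IsSubrep.inf {v : HQ V V} {N N' : ∀ x, Submodule ℂ (V x)} (h : IsSubrep v N)
    (h' : IsSubrep v N') : IsSubrep v (N ⊓ N') := fun x y a => by
  rintro _ ⟨z, hz, rfl⟩
  exact ⟨h.apply_mem a hz.1, h'.apply_mem a hz.2⟩

/-- The families of nilpotent maps describing the Schubert cell of `S`. -/
def nilFam (F : ∀ x, Filtration (V x)) (π : ∀ x, V x →ₗ[ℂ] S x) :
    Submodule ℂ (∀ x, V x →ₗ[ℂ] V x) :=
  Submodule.pi Set.univ fun x => nilHom (F x) (π x)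

variable {π : ∀ x, V x →ₗ[ℂ] S x}

theorem mem_nilFam {n : ∀ x, V x →ₗ[ℂ] V x} : n ∈ nilFam F π ↔ ∀ x, n x ∈ nilHom (F x) (π x) := by
  simp [nilFam]

/-- Transport of a representation by the unipotent automorphisms `1 + n`. -/
def transport (n : ∀ x, V x →ₗ[ℂ] V x) (v : HQ V V) : HQ V V := fun x y a =>
  (LinearMap.id + n y) ∘ₗ v x y a ∘ₗ (LinearMap.id - n x)

/-- As n² = 0, the inverse of 1 + n is 1 - n. -/
theorem transport_neg_transport {n : ∀ x, V x →ₗ[ℂ] V x} (hn : n ∈ nilFam F π) (v : HQ V V) :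
    transport (-n) (transport n v) = v := by
  have h := fun x z => nilHom_apply_apply (mem_nilFam.1 hn x) z
  funext x y a
  ext z
  simp [transport, h]

theorem isSubrep_transport {n : ∀ x, V x →ₗ[ℂ] V x} (hn : n ∈ nilFam F π) {v : HQ V V} :
    IsSubrep (transport n v) (fun x => (S x).map (LinearMap.id + n x)) ↔ IsSubrep v S := by
  have h := fun x z => nilHom_apply_apply (mem_nilFam.1 hn x) z
  constructor
  · rintro h1 x y a _ ⟨z, hz, rfl⟩
    have h2 := h1.apply_mem a (Submodule.mem_map_of_mem (f := LinearMap.id + n x) hz)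
    obtain ⟨s, hs, hs'⟩ := h2
    have h3 := congrArg (LinearMap.id - n y : V y →ₗ[ℂ] V y) hs'
    have h4 : v x y a z = s := by simpa [transport, h] using h3.symm
    rw [h4]
    exact hs
  · rintro h1 x y a _ ⟨_, ⟨z, hz, rfl⟩, rfl⟩
    refine ⟨v x y a z, h1.apply_mem a hz, ?_⟩
    simp [transport, h]

variable [∀ x, FiniteDimensional ℂ (V x)]

theorem isPolyMap_transport [Finite Q₀] [∀ x y : Q₀, Finite (x ⟶ y)] :
    IsPolyMap (fun p : nilFam F π × stabilizing S => transport p.1.1 p.2.1) := by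
  refine isPolyMap_pi fun x => isPolyMap_pi fun y => isPolyMap_pi fun a => ?_
  let E := nilFam F π × stabilizing S
  let N (x : Q₀) : E →ₗ[ℂ] (V x →ₗ[ℂ] V x) :=
    LinearMap.proj x ∘ₗ (nilFam F π).subtype ∘ₗ LinearMap.fst ℂ _ _
  let A : E →ₗ[ℂ] (V x →ₗ[ℂ] V y) :=
    LinearMap.proj a ∘ₗ LinearMap.proj y ∘ₗ LinearMap.proj x ∘ₗ (stabilizing S).subtype ∘ₗ
      LinearMap.snd ℂ _ _
  have h1 : IsPolyMap (fun p : E => (A p) ∘ₗ (LinearMap.id - N x p)) :=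
    IsPolyMap.bilinear (LinearMap.llcomp ℂ (V x) (V x) (V y)) (IsPolyMap.linear A)
      ((IsPolyMap.const _).sub (IsPolyMap.linear (N x)))
  exact IsPolyMap.bilinear (LinearMap.llcomp ℂ (V x) (V y) (V y))
    ((IsPolyMap.const LinearMap.id).add (IsPolyMap.linear (N y))) h1

theorem exists_nilFam_of_position_eq (hπ : ∀ x, ∀ s : S x, π x s = s)
    (hπF : ∀ x i, ∀ z ∈ F x i, (π x z : V x) ∈ F x i) {N : ∀ x, Submodule ℂ (V x)}
    (h : position F N = position F S) :
    ∃ n ∈ nilFam F π, N = fun x => (S x).map (LinearMap.id + n x) := by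
  choose n hn hn' using fun x => exists_nilHom_map_eq (hπ x) (hπF x) (N := N x)
    fun i => congrFun (congrFun h x) i
  exact ⟨n, mem_nilFam.2 hn, funext hn'⟩

theorem unipotent_mem_borel {n : ∀ x, V x →ₗ[ℂ] V x} (hn : n ∈ nilFam F π) :
    (fun x => unipotent (n x) (nilHom_apply_apply (mem_nilFam.1 hn x))) ∈ borel F := by
  intro x i
  have hF := (mem_nilFam.1 hn x).1
  refine le_antisymm ?_ fun z hz => ?_
  · rintro _ ⟨z, hz, rfl⟩
    exact Submodule.add_mem _ hz (hF i z hz)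
  · refine ⟨z - n x z, Submodule.sub_mem _ hz (hF i z hz), ?_⟩
    change (z - n x z) + n x (z - n x z) = z
    rw [map_sub, nilHom_apply_apply (mem_nilFam.1 hn x)]
    abel

/-- Families in equal position differ by a unipotent 1 + n preserving the filtrations. With
`position_eq_of_mem_schubertCell` this says that cells are exactly the position classes. -/
theorem mem_schubertCell_of_position_eq {N : GrFam (fun x => finrank ℂ (S x)) V}
    (h : position F (fun x => (N x).1) = position F S) : N ∈ schubertCell F S := by
  choose π hπ hπF using fun x => (F x).exists_retraction (S x)
  obtain ⟨n, hn, hN⟩ := exists_nilFam_of_position_eq hπ hπF h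
  exact ⟨_, unipotent_mem_borel hn, fun x => congrFun hN x⟩

theorem position_eq_of_mem_schubertCell {N : GrFam (fun x => finrank ℂ (S x)) V}
    (h : N ∈ schubertCell F S) : position F (fun x => (N x).1) = position F S := by
  obtain ⟨g, hg, hN⟩ := h
  funext x i
  have h1 : F x i ⊓ (S x).map (g x : V x →ₗ[ℂ] V x)
      = (F x i ⊓ S x).map (g x : V x →ₗ[ℂ] V x) := by
    conv_lhs => rw [← hg x i]
    exact (Submodule.map_inf _ (g x).injective).symm
  rw [position, hN x, h1]
  exact LinearEquiv.finrank_map_eq (g x) _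

variable [Fintype Q₀]

/-- The map n is determined by the filtered map S → V/S it induces. Conversely, such a map lifts
through the filtered section τ of V → V/S with image in ker π. -/
theorem finrank_nilFam (hπ : ∀ x, ∀ s : S x, π x s = s)
    (hπF : ∀ x i, ∀ z ∈ F x i, (π x z : V x) ∈ F x i) :
    finrank ℂ (nilFam F π)
      = finrank ℂ (gQFil (fun x => (F x).sub (S x)) (fun x => (F x).quot (S x))) := by
  let f : nilFam F π →ₗ[ℂ] gQFil (fun x => (F x).sub (S x)) (fun x => (F x).quot (S x)) :=
    { toFun := fun n => ⟨fun x => (S x).mkQ ∘ₗ n.1 x ∘ₗ (S x).subtype, fun x i z hz =>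
        ⟨n.1 x z, (mem_nilFam.1 n.2 x).1 i z hz, rfl⟩⟩
      map_add' := fun n n' => by ext x z; simp
      map_smul' := fun c n => by ext x z; simp }
  refine LinearEquiv.finrank_eq (LinearEquiv.ofBijective f ⟨?_, ?_⟩)
  · rw [← LinearMap.ker_eq_bot, LinearMap.ker_eq_bot']
    intro n h0
    ext x z
    have hn := mem_nilFam.1 n.2 x
    have h1 : (S x).mkQ (n.1 x (π x z)) = 0 :=
      LinearMap.congr_fun (congrFun (congrArg Subtype.val h0) x) (π x z)
    rw [hn.2.2, Submodule.mkQ_apply, Submodule.Quotient.mk_eq_zero] at h1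
    have h2 := hπ x ⟨_, h1⟩
    rw [hn.2.1] at h2
    exact (congrArg Subtype.val h2).symm
  · intro ψ
    choose σ hσ using fun x => (S x).mkQ.exists_rightInverse_of_surjective
      (LinearMap.range_eq_top.2 (S x).mkQ_surjective)
    have hσ' : ∀ x q, (S x).mkQ (σ x q) = q := fun x q => LinearMap.congr_fun (hσ x) q
    let τ : ∀ x, (V x ⧸ S x) →ₗ[ℂ] V x := fun x => σ x - (S x).subtype ∘ₗ π x ∘ₗ σ x
    have hτ : ∀ x q, τ x q = σ x q - π x (σ x q) := fun x q => rfl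
    have hτπ : ∀ x q, π x (τ x q) = 0 := fun x q => by rw [hτ, map_sub, hπ, sub_self]
    have hτq : ∀ x q, (S x).mkQ (τ x q) = q := fun x q => by
      rw [hτ, map_sub, hσ', Submodule.mkQ_apply _ (π x (σ x q) : V x),
        (Submodule.Quotient.mk_eq_zero _).2 (π x (σ x q)).2, sub_zero]
    have hτF : ∀ x i, ∀ q ∈ (F x).quot (S x) i, τ x q ∈ F x i := by
      rintro x i _ ⟨z, hz, rfl⟩
      have h1 : σ x ((S x).mkQ z) - z ∈ S x := by
        rw [← Submodule.Quotient.mk_eq_zero, ← Submodule.mkQ_apply, map_sub, hσ', sub_self]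
      have h2 := hπ x ⟨_, h1⟩
      have h3 : τ x ((S x).mkQ z) = z - π x z := by
        have h4 := congrArg Subtype.val h2
        simp only [map_sub, AddSubgroupClass.coe_sub] at h4
        rw [hτ, sub_eq_sub_iff_sub_eq_sub, ← h4]
      rw [h3]
      exact Submodule.sub_mem _ hz (hπF x i z hz)
    refine ⟨⟨fun x => τ x ∘ₗ ψ.1 x ∘ₗ π x, mem_nilFam.2 fun x => ⟨fun i z hz => ?_, fun z => ?_,
      fun z => ?_⟩⟩, ?_⟩
    · exact hτF x i _ (ψ.2 x i _ (hπF x i z hz))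
    · exact hτπ x _
    · simp [hπ]
    · ext x z
      change (S x).mkQ (τ x (ψ.1 x (π x z))) = _
      rw [hτq, hπ]

/-- Preserving S is the vanishing of the induced maps S → V/S, and all such maps arise. With
`finrank_nilFam`, the incidence parameter space has dimension dim H(V) + eul(S, V/S). -/
theorem finrank_stabilizing [∀ x y : Q₀, Finite (x ⟶ y)] :
    finrank ℂ (stabilizing S) + finrank ℂ (HQ (fun x => S x) (fun x => V x ⧸ S x))
      = finrank ℂ (HQ V V) := by
  let f : HQ V V →ₗ[ℂ] HQ (fun x => S x) (fun x => V x ⧸ S x) :=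
    { toFun := fun v x y a => (S y).mkQ ∘ₗ v x y a ∘ₗ (S x).subtype
      map_add' := fun n n' => by ext x y a z; simp
      map_smul' := fun c n => by ext x y a z; simp }
  have hker : LinearMap.ker f = stabilizing S := by
    ext v
    rw [LinearMap.mem_ker]
    constructor
    · rintro h x y a _ ⟨z, hz, rfl⟩
      have := LinearMap.congr_fun (congrFun (congrFun (congrFun h x) y) a) ⟨z, hz⟩
      exact (Submodule.Quotient.mk_eq_zero _).1 this
    · intro h
      ext x y a z
      exact (Submodule.Quotient.mk_eq_zero _).2 (IsSubrep.apply_mem h a z.2)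
  have hsurj : LinearMap.range f = ⊤ := by
    rw [LinearMap.range_eq_top]
    intro ψ
    choose σ hσ using fun x => (S x).mkQ.exists_rightInverse_of_surjective
      (LinearMap.range_eq_top.2 (S x).mkQ_surjective)
    choose p hp using fun x => (S x).subtype.exists_leftInverse_of_injective (S x).ker_subtype
    refine ⟨fun x y a => σ y ∘ₗ ψ x y a ∘ₗ p x, ?_⟩
    ext x y a z
    have h1 := LinearMap.congr_fun (hσ y) (ψ x y a (p x z))
    have h2 : p x z = z := LinearMap.congr_fun (hp x) z
    rw [h2] at h1
    change (S y).mkQ (σ y (ψ x y a (p x z))) = _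
    rw [h2]
    exact h1
  have h := f.finrank_range_add_finrank_ker
  rw [hker, hsurj, finrank_top] at h
  omega

end Incidence

end FilteredQuiver

namespace FilteredQuiver

open Module Filter Topology

set_option linter.unusedSectionVars false

universe u₀ u₁ u₂ u₃

/-! ### Limits in Grassmannians -/

section Grassmannian

variable {V : Type u₂} [AddCommGroup V] [Module ℂ V]

theorem Frame.continuous_linear {r : ℕ} {E : Type*} [AddCommGroup E] [Module ℂ E]
    [TopologicalSpace E] [IsTopologicalAddGroup E] [ContinuousSMul ℂ E] (l : V →ₗ[ℂ] E) (i : Fin r) :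
    Continuous fun f : Frame r V => l (f.1 i) := by
  let : TopologicalSpace V := moduleTopology ℂ V
  have : IsModuleTopology ℂ V := ⟨rfl⟩
  have h1 : Continuous l := IsModuleTopology.continuous_of_linearMap l
  have h2 : Continuous fun f : Frame r V => f.1 :=
    continuous_subtype_val (p := fun f : Fin r → V => LinearIndependent ℂ f)
  exact h1.comp ((continuous_apply i).comp h2)

theorem continuous_frameSpan {r : ℕ} : Continuous (Frame.span : Frame r V → Gr r V) :=
  continuous_coinduced_rng

theorem isClosed_le_finrank_inf [FiniteDimensional ℂ V] (A : Submodule ℂ V) (r k : ℕ) :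
    IsClosed {N : Gr r V | k ≤ finrank ℂ (A ⊓ N.1 : Submodule ℂ V)} := by
  refine isClosed_coinduced.2 ?_
  let e := (finBasis ℂ (V ⧸ A)).equivFun
  -- dim (A ∩ N) < k means that the image of N in V/A has at least r + 1 - k independent vectors, an
  -- open condition on frames. If k > r, the complement is everything.
  have key : (Frame.span ⁻¹' {N : Gr r V | k ≤ finrank ℂ (A ⊓ N.1 : Submodule ℂ V)})ᶜ
      = ⋃ a : Fin (r + 1 - k) → Fin r → ℂ, {f : Frame r V | k ≤ r ∧ LinearIndependent ℂ
          fun i => e (A.mkQ (∑ j, a i j • f.1 j))} ∪ {_f | r < k} := by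
    ext f
    have h0 : finrank ℂ (Submodule.span ℂ (Set.range f.1)) = r := by
      simpa using finrank_span_eq_card f.2
    have h1 := finrank_map_mkQ_add A (Submodule.span ℂ (Set.range f.1))
    rw [h0, inf_comm] at h1
    let l : (Fin r → ℂ) →ₗ[ℂ] (Fin (finrank ℂ (V ⧸ A)) → ℂ) :=
      e.toLinearMap ∘ₗ A.mkQ ∘ₗ Fintype.linearCombination ℂ f.1
    have h2 : finrank ℂ (LinearMap.range l)
        = finrank ℂ ((Submodule.span ℂ (Set.range f.1)).map A.mkQ) := by
      rw [LinearMap.range_comp, LinearMap.range_comp, Fintype.range_linearCombination]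
      exact LinearEquiv.finrank_map_eq e _
    have h3 : (∃ a : Fin (r + 1 - k) → Fin r → ℂ, LinearIndependent ℂ
          fun i => e (A.mkQ (∑ j, a i j • f.1 j)))
        ↔ r + 1 - k ≤ finrank ℂ ((Submodule.span ℂ (Set.range f.1)).map A.mkQ) := by
      rw [← h2, le_finrank_range_iff]
      rfl
    change ¬ (k ≤ finrank ℂ (A ⊓ Submodule.span ℂ (Set.range f.1) : Submodule ℂ V)) ↔ _
    simp only [Set.mem_iUnion, Set.mem_union, Set.mem_ofPred_eq, exists_or, exists_and_left, h3,
      exists_const]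
    omega
  rw [← isOpen_compl_iff, key]
  refine isOpen_iUnion fun a => IsOpen.union (isOpen_const.and ?_) isOpen_const
  refine isOpen_setOfPred_linearIndependent.preimage (continuous_pi fun i => ?_)
  have : (fun f : Frame r V => e (A.mkQ (∑ j, a i j • f.1 j)))
      = fun f => ∑ j, a i j • (e.toLinearMap ∘ₗ A.mkQ) (f.1 j) := by
    funext f
    simp
  rw [this]
  exact continuous_finsetSum _ fun j _ =>
    (Frame.continuous_linear (e.toLinearMap ∘ₗ A.mkQ) j).const_smul (a i j)

/-- Turns membership in a moving subspace into an equation that passes to limits. -/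
theorem eq_sum_inner_of_mem_span {E : Type*} [NormedAddCommGroup E] [InnerProductSpace ℂ E]
    {ι : Type*} [Fintype ι] {g : ι → E} (hg : Orthonormal ℂ g) {z : E} :
    z ∈ Submodule.span ℂ (Set.range g) ↔ z = ∑ i, inner ℂ (g i) z • g i := by
  constructor
  · intro hz
    obtain ⟨c, rfl⟩ := (Submodule.mem_span_range_iff_exists_fun ℂ).1 hz
    refine Finset.sum_congr rfl fun i _ => ?_
    rw [hg.inner_right_fintype]
  · intro hz
    rw [hz]
    exact Submodule.sum_mem _ fun i _ => Submodule.smul_mem _ _ (Submodule.subset_span ⟨i, rfl⟩)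

/-- Orthonormal frames of the standard hermitian space. -/
abbrev OrthoFrame (r d : ℕ) : Type :=
  {g : Fin r → EuclideanSpace ℂ (Fin d) // Orthonormal ℂ g}

instance OrthoFrame.compactSpace (r d : ℕ) : CompactSpace (OrthoFrame r d) := by
  suffices h : IsCompact {g : Fin r → EuclideanSpace ℂ (Fin d) | Orthonormal ℂ g} from
    isCompact_iff_compactSpace.1 h
  refine Metric.isCompact_of_isClosed_isBounded ?_ ?_
  · simp only [orthonormal_iff_ite]
    simp only [Set.ofPred_forall]
    refine isClosed_iInter fun i => isClosed_iInter fun j => ?_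
    exact isClosed_eq (by fun_prop) continuous_const
  · refine (Metric.isBounded_closedBall (x := (0 : Fin r → EuclideanSpace ℂ (Fin d)))
      (r := 1)).subset fun g hg => ?_
    rw [mem_closedBall_zero_iff, pi_norm_le_iff_of_nonneg zero_le_one]
    exact fun i => (hg.1 i).le

/-- The frame of `V` obtained from an orthonormal frame by a linear isomorphism. -/
def OrthoFrame.toFrame {r d : ℕ} (e : V ≃ₗ[ℂ] EuclideanSpace ℂ (Fin d)) (g : OrthoFrame r d) :
    Frame r V :=
  ⟨fun i => e.symm (g.1 i), g.2.linearIndependent.map' e.symm.toLinearMap e.symm.ker⟩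

theorem OrthoFrame.continuous_toFrame {r d : ℕ} (e : V ≃ₗ[ℂ] EuclideanSpace ℂ (Fin d)) :
    Continuous (OrthoFrame.toFrame e : OrthoFrame r d → Frame r V) := by
  let : TopologicalSpace V := moduleTopology ℂ V
  have : IsModuleTopology ℂ V := ⟨rfl⟩
  have : ContinuousAdd V := IsModuleTopology.toContinuousAdd ℂ V
  have : IsTopologicalAddGroup V := IsModuleTopology.topologicalAddGroup ℂ V
  have h1 : Continuous e.symm.toLinearMap := LinearMap.continuous_of_finiteDimensional _
  refine Continuous.subtype_mk (continuous_pi fun i => ?_) _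
  exact h1.comp ((continuous_apply i).comp continuous_subtype_val)

theorem OrthoFrame.mem_span_toFrame {r d : ℕ} (e : V ≃ₗ[ℂ] EuclideanSpace ℂ (Fin d))
    (g : OrthoFrame r d) (z : V) :
    z ∈ (g.toFrame e).span.1 ↔ e z = ∑ i, inner ℂ (g.1 i) (e z) • g.1 i := by
  rw [← eq_sum_inner_of_mem_span g.2]
  have : (g.toFrame e).span.1 = (Submodule.span ℂ (Set.range g.1)).map e.symm.toLinearMap := by
    rw [Submodule.map_span, ← Set.range_comp]
    rfl
  rw [this]
  constructor
  · rintro ⟨y, hy, rfl⟩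
    simpa using hy
  · intro h
    exact ⟨e z, h, by simp⟩

/-- The compact space of orthonormal frames surjects onto the Grassmannian, so limits of subspaces
can be taken on frames. -/
theorem OrthoFrame.exists_span_toFrame_eq {r d : ℕ} (e : V ≃ₗ[ℂ] EuclideanSpace ℂ (Fin d))
    (N : Gr r V) : ∃ g : OrthoFrame r d, (g.toFrame e).span = N := by
  let M := N.1.map e.toLinearMap
  have hM : finrank ℂ M = r := by rw [← N.2]; exact LinearEquiv.finrank_map_eq e _
  let b := (stdOrthonormalBasis ℂ M).reindex (finCongr hM)
  have hb : Orthonormal ℂ fun i => (b i : EuclideanSpace ℂ (Fin d)) :=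
    b.orthonormal.comp_linearIsometry M.subtypeₗᵢ
  refine ⟨⟨_, hb⟩, Subtype.ext ?_⟩
  have h1 : Submodule.span ℂ (Set.range fun i => (b i : EuclideanSpace ℂ (Fin d))) = M := by
    have h2 := congrArg (Submodule.map M.subtype) b.toBasis.span_eq
    rw [Submodule.map_span, ← Set.range_comp, Submodule.map_top, Submodule.range_subtype] at h2
    convert h2 using 3
    ext i
    simp
  ext z
  rw [OrthoFrame.mem_span_toFrame, ← eq_sum_inner_of_mem_span hb, h1]
  simp [M]

end Grassmannian

/-! ### Subrepresentations and positions under limits of representations. -/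

section Limits

variable {Q₀ : Type u₀} [Quiver.{u₁} Q₀] [Finite Q₀]
variable {V : Q₀ → Type u₂} [∀ x, AddCommGroup (V x)] [∀ x, Module ℂ (V x)]
  [∀ x, FiniteDimensional ℂ (V x)]

/-- Subrepresentations in a closed set of positions survive in limits. -/
theorem exists_isSubrep_of_frequently {α : Q₀ → ℕ} {Ω : Set (GrFam α V)} (hΩ : IsClosed Ω)
    (v u : HQ V V)
    (h : ∃ᶠ t in 𝓝[≠] (0 : ℂ), ∃ N ∈ Ω, IsSubrep (v + t • u) fun x => (N x).1) :
    ∃ N ∈ Ω, IsSubrep v fun x => (N x).1 := by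
  classical
  let e : ∀ x, V x ≃ₗ[ℂ] EuclideanSpace ℂ (Fin (finrank ℂ (V x))) := fun x =>
    LinearEquiv.ofFinrankEq _ _ (by simp)
  let X := ∀ x, OrthoFrame (α x) (finrank ℂ (V x))
  let sp : X → GrFam α V := fun g x => ((g x).toFrame (e x)).span
  have hsp : Continuous sp := continuous_pi fun x =>
    continuous_frameSpan.comp ((OrthoFrame.continuous_toFrame (e x)).comp (continuous_apply x))
  have h' : ∃ᶠ t in 𝓝[≠] (0 : ℂ), ∃ g : X, sp g ∈ Ω ∧ IsSubrep (v + t • u) fun x => (sp g x).1 := by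
    refine h.mono fun t ⟨N, hN, hs⟩ => ?_
    choose g hg using fun x => OrthoFrame.exists_span_toFrame_eq (e x) (N x)
    have : sp g = N := funext hg
    exact ⟨g, this ▸ hN, by rw [this]; exact hs⟩
  obtain ⟨t₀, g₀, -⟩ := h'.exists
  let good : Set ℂ := {t | ∃ g : X, sp g ∈ Ω ∧ IsSubrep (v + t • u) fun x => (sp g x).1}
  have hchoice : ∀ t, ∃ g : X, t ∈ good → sp g ∈ Ω ∧ IsSubrep (v + t • u) fun x => (sp g x).1 := by
    intro t
    by_cases ht : t ∈ good
    · obtain ⟨g, hg⟩ := ht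
      exact ⟨g, fun _ => hg⟩
    · exact ⟨g₀, fun h => absurd h ht⟩
  choose g hg using hchoice
  have : NeBot (𝓝[≠] (0 : ℂ) ⊓ 𝓟 good) := frequently_mem_iff_neBot.1 h'
  -- Along an ultrafilter concentrated on the good parameters, the chosen frames converge by
  -- compactness; values chosen at other parameters play no role.
  let U := Ultrafilter.of (𝓝[≠] (0 : ℂ) ⊓ 𝓟 good)
  have hU : (U : Filter ℂ) ≤ 𝓝[≠] (0 : ℂ) ⊓ 𝓟 good := Ultrafilter.of_le _
  have hgood : ∀ᶠ t in (U : Filter ℂ), t ∈ good := (hU.trans inf_le_right) (mem_principal_self _)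
  have ht0 : Tendsto (fun t : ℂ => t) U (𝓝 0) := (hU.trans inf_le_left).trans nhdsWithin_le_nhds
  obtain ⟨g', -, hg'⟩ := isCompact_univ.ultrafilter_le_nhds (U.map g) (by simp)
  have hlim : Tendsto g U (𝓝 g') := hg'
  refine ⟨sp g', hΩ.mem_of_tendsto ((hsp.tendsto g').comp hlim)
    (hgood.mono fun t ht => (hg t ht).1), ?_⟩
  have hcoord : ∀ x (i : Fin (α x)), Tendsto (fun t => (g t x).1 i) U (𝓝 ((g' x).1 i)) := by
    intro x i
    have h1 : Continuous fun f : X => (f x).1 i :=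
      (continuous_apply i).comp (continuous_subtype_val.comp (continuous_apply x))
    exact (h1.tendsto g').comp hlim
  intro x y a
  rw [Submodule.map_le_iff_le_comap]
  change Submodule.span ℂ _ ≤ _
  rw [Submodule.span_le]
  rintro _ ⟨i, rfl⟩
  change v x y a ((e x).symm ((g' x).1 i)) ∈ ((g' y).toFrame (e y)).span.1
  rw [OrthoFrame.mem_span_toFrame]
  let A (v : HQ V V) : EuclideanSpace ℂ (Fin (finrank ℂ (V x))) →ₗ[ℂ]
      EuclideanSpace ℂ (Fin (finrank ℂ (V y))) := (e y).toLinearMap ∘ₗ v x y a ∘ₗ (e x).symm.toLinearMap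
  have hA : ∀ v, Continuous (A v) := fun v => LinearMap.continuous_of_finiteDimensional _
  let z : ℂ → EuclideanSpace ℂ (Fin (finrank ℂ (V y))) := fun t =>
    A v ((g t x).1 i) + t • A u ((g t x).1 i)
  have hz : Tendsto z U (𝓝 (A v ((g' x).1 i))) := by
    have h1 := ((hA v).tendsto _).comp (hcoord x i)
    have h2 := ht0.smul (((hA u).tendsto _).comp (hcoord x i))
    simpa using h1.add h2
  have hsum : Tendsto (fun t => ∑ j, inner ℂ ((g t y).1 j) (z t) • (g t y).1 j) U
      (𝓝 (∑ j, inner ℂ ((g' y).1 j) (A v ((g' x).1 i)) • (g' y).1 j)) :=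
    tendsto_finsetSum _ fun j _ => ((hcoord y j).inner hz).smul (hcoord y j)
  have heq : ∀ᶠ t in (U : Filter ℂ), z t = ∑ j, inner ℂ ((g t y).1 j) (z t) • (g t y).1 j := by
    refine hgood.mono fun t ht => ?_
    have h1 : (v + t • u) x y a ((e x).symm ((g t x).1 i)) ∈ ((g t y).toFrame (e y)).span.1 :=
      (hg t ht).2.apply_mem a (Submodule.subset_span ⟨i, rfl⟩)
    rw [OrthoFrame.mem_span_toFrame] at h1
    have h2 : e y ((v + t • u) x y a ((e x).symm ((g t x).1 i))) = z t := by
      simp [z, A]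
    rwa [h2] at h1
  exact tendsto_nhds_unique hz (hsum.congr' (heq.mono fun t ht => ht.symm))

/-- Every v is a limit, along a line, of points of the nonempty line-open set A. -/
theorem exists_isSubrep_of_lineOpen {α : Q₀ → ℕ} {Ω : Set (GrFam α V)} (hΩ : IsClosed Ω)
    {A : Set (HQ V V)} (hA : LineOpen A) (hne : A.Nonempty)
    (h : ∀ v ∈ A, ∃ N ∈ Ω, IsSubrep v fun x => (N x).1) : IsQIntersecting Ω := by
  intro v
  obtain ⟨w, hw⟩ := hne
  exact exists_isSubrep_of_frequently hΩ v (w - v)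
    ((hA.eventually hw v).frequently.mono fun t ht => h _ ht)

variable (F : ∀ x, Filtration (V x))

theorem isClosed_position_le {α : Q₀ → ℕ} (d : Q₀ → ℕ → ℕ) :
    IsClosed {N : GrFam α V | ∀ x i, d x i ≤ position F (fun x => (N x).1) x i} := by
  have h : {N : GrFam α V | ∀ x i, d x i ≤ position F (fun x => (N x).1) x i}
      = ⋂ x, ⋂ i, (fun N : GrFam α V => N x) ⁻¹'
        {N | d x i ≤ finrank ℂ (F x i ⊓ N.1 : Submodule ℂ (V x))} := by
    ext N
    rw [Set.mem_iInter₂]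
    rfl
  rw [h]
  exact isClosed_iInter fun x => isClosed_iInter fun i =>
    (isClosed_le_finrank_inf (F x i) (α x) (d x i)).preimage (continuous_apply x)

/-- Semicontinuity: intersection dimensions are constant on the cell, and the conditions bounding
them below are closed. -/
theorem position_le_of_mem_schubertVariety {S : ∀ x, Submodule ℂ (V x)}
    {N : GrFam (fun x => finrank ℂ (S x)) V} (hN : N ∈ schubertVariety F S) (x : Q₀) (i : ℕ) :
    position F S x i ≤ position F (fun x => (N x).1) x i := by
  have h : schubertVariety F S
      ⊆ {N | ∀ x i, position F S x i ≤ position F (fun x => (N x).1) x i} :=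
    closure_minimal (fun M hM x i => by rw [position_eq_of_mem_schubertCell hM])
      (isClosed_position_le F _)
  exact h hN x i

theorem finite_range_position : (Set.range (position F)).Finite := by
  obtain ⟨L, hL⟩ := Filtration.exists_common_top F
  let Φ : (∀ x, Fin (L + 1) → Fin (finrank ℂ (V x) + 1)) → Q₀ → ℕ → ℕ := fun τ x i =>
    τ x ⟨min i L, by omega⟩
  refine (Set.finite_range Φ).subset ?_
  rintro _ ⟨N, rfl⟩
  refine ⟨fun x i => ⟨position F N x i, Nat.lt_succ_of_le (Submodule.finrank_le _)⟩, ?_⟩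
  funext x i
  change position F N x (min i L) = _
  rcases le_total i L with h | h
  · rw [min_eq_left h]
  · rw [min_eq_right h, position_of_eq_top (hL x),
      position_of_eq_top (top_le_iff.1 (hL x ▸ (F x).monotone h))]

theorem finrank_eq_of_position_eq {N S : ∀ x, Submodule ℂ (V x)}
    (h : position F N = position F S) (x : Q₀) : finrank ℂ (N x) = finrank ℂ (S x) := by
  obtain ⟨L, hL⟩ := Filtration.exists_common_top F
  rw [← position_of_eq_top (hL x) N, ← position_of_eq_top (hL x) S, h]

/-- Limits of subrepresentations whose positions satisfy a given condition. -/
theorem exists_isSubrep_position_le (P : (Q₀ → ℕ → ℕ) → Prop) (v u : HQ V V)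
    (h : ∃ᶠ t in 𝓝[≠] (0 : ℂ), ∃ N, IsSubrep (v + t • u) N ∧ P (position F N)) :
    ∃ S N : ∀ x, Submodule ℂ (V x), P (position F S) ∧ IsSubrep v N ∧
      (∀ x, finrank ℂ (N x) = finrank ℂ (S x)) ∧ ∀ x i, position F S x i ≤ position F N x i := by
  have : Finite (Set.range (position F)) := (finite_range_position F).to_subtype
  -- Only finitely many positions exist, so one of them occurs frequently and its closed position
  -- condition can be carried to the limit.
  have h1 : ∃ τ : Set.range (position F), ∃ᶠ t in 𝓝[≠] (0 : ℂ), ∃ N, IsSubrep (v + t • u) N ∧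
      P (position F N) ∧ position F N = τ := by
    by_contra! hcon
    have h2 := eventually_all.2 hcon
    refine h (h2.mono fun t ht => ?_)
    rintro ⟨N, hN, hP⟩
    exact ht ⟨_, N, rfl⟩ N hN hP rfl
  obtain ⟨τ, hτ⟩ := h1
  obtain ⟨t, S, -, hP, hS⟩ := hτ.exists
  obtain ⟨N, hN, hs⟩ := exists_isSubrep_of_frequently
    (isClosed_position_le F (α := fun x => finrank ℂ (S x)) (position F S)) v u
    (hτ.mono fun t ⟨N, hN, _, hNτ⟩ => by
      have h3 : position F N = position F S := hNτ.trans hS.symm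
      exact ⟨fun x => ⟨N x, finrank_eq_of_position_eq F h3 x⟩,
        fun x i => (congrFun (congrFun h3 x) i).ge, hN⟩)
  exact ⟨S, fun x => (N x).1, hP, hs, fun x => (N x).2, hN⟩

end Limits

end FilteredQuiver

namespace FilteredQuiver

open Module Filter Topology

set_option linter.unusedSectionVars false

universe u₀ u₁ u₂ u₃

/-! ### Filtered extensions of generic representations -/

section Main

variable {Q₀ : Type u₀} [Quiver.{u₁} Q₀] [Fintype Q₀] [∀ x y : Q₀, Finite (x ⟶ y)]
variable {V : Q₀ → Type u₂} [∀ x, AddCommGroup (V x)] [∀ x, Module ℂ (V x)]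
  [∀ x, FiniteDimensional ℂ (V x)]
variable {W : Q₀ → Type u₃} [∀ x, AddCommGroup (W x)] [∀ x, Module ℂ (W x)]
  [∀ x, FiniteDimensional ℂ (W x)]
variable (F : ∀ x, Filtration (V x)) (G : ∀ x, Filtration (W x))

theorem genericExt_eq_zero_iff :
    genericExt F G = 0 ↔ ∃ v w, Function.Surjective (delta F G v w) := by
  have key : ∀ v w, finrank ℂ (Ext F G v w) = 0 ↔ Function.Surjective (delta F G v w) := by
    intro v w
    rw [finrank_zero_iff, Submodule.Quotient.subsingleton_iff, LinearMap.range_eq_top]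
  constructor
  · intro h
    obtain ⟨p, hp⟩ := Nat.sInf_mem (Set.range_nonempty fun p : HQ V V × HQ W W =>
      finrank ℂ (Ext F G p.1 p.2))
    exact ⟨p.1, p.2, (key _ _).1 (hp.trans h)⟩
  · rintro ⟨v, w, h⟩
    refine Nat.le_zero.1 (((key v w).2 h) ▸ ?_)
    exact Nat.sInf_le ⟨(v, w), rfl⟩

/-- The map `(v, w) ↦ δ_{v,w}`. -/
def deltaLinear : HQ V V × HQ W W →ₗ[ℂ] gQFil F G →ₗ[ℂ] HQ V W where
  toFun p := delta F G p.1 p.2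
  map_add' p q := by
    ext φ x y a z
    simp [delta, commMap]
    abel
  map_smul' c p := by
    ext φ x y a z
    simp [delta, commMap, smul_sub]

variable {F G}

theorem delta_apply (v : HQ V V) (w : HQ W W) (φ : gQFil F G) {x y : Q₀} (a : x ⟶ y) (z : V x) :
    delta F G v w φ x y a z = φ.1 y (v x y a z) - w x y a (φ.1 x z) := rfl

theorem surjective_delta_iff {v : HQ V V} {w : HQ W W} :
    Function.Surjective (delta F G v w)
      ↔ finrank ℂ (HQ V W) ≤ finrank ℂ (LinearMap.range (deltaLinear F G (v, w))) := by
  rw [← LinearMap.range_eq_top]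
  constructor
  · intro h
    change _ ≤ finrank ℂ (LinearMap.range (delta F G v w))
    rw [h, finrank_top]
  · intro h
    exact Submodule.eq_top_of_finrank_eq (le_antisymm (Submodule.finrank_le _) h)

theorem exists_gQFil_extension (S : ∀ x, Submodule ℂ (V x))
    (ψ : gQFil (fun x => (F x).sub (S x)) G) :
    ∃ Ψ : gQFil F G, ∀ x (s : S x), Ψ.1 x s = ψ.1 x s := by
  choose π hπ hπF using fun x => (F x).exists_retraction (S x)
  refine ⟨⟨fun x => ψ.1 x ∘ₗ π x, fun x i z hz => ψ.2 x i _ (hπF x i z hz)⟩, fun x s => ?_⟩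
  change ψ.1 x (π x s) = _
  rw [hπ]

/-- The restriction of a representation to a subrepresentation. -/
def IsSubrep.restrict {v : HQ V V} {S : ∀ x, Submodule ℂ (V x)} (h : IsSubrep v S) :
    HQ (fun x => S x) (fun x => S x) := fun _ _ a => (v _ _ a).restrict fun _ hz => h.apply_mem a hz

/-- A target on S extends to V by linear projections; a solution on V restricts to a filtered
solution on S. -/
theorem IsSubrep.surjective_delta_restrict {v : HQ V V} {w : HQ W W}
    {S : ∀ x, Submodule ℂ (V x)} (hS : IsSubrep v S) (h : Function.Surjective (delta F G v w)) :
    Function.Surjective (delta (fun x => (F x).sub (S x)) G hS.restrict w) := by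
  intro η
  choose p hp using fun x => (S x).subtype.exists_leftInverse_of_injective (S x).ker_subtype
  obtain ⟨Φ, hΦ⟩ := h fun x y a => η x y a ∘ₗ p x
  refine ⟨⟨fun x => Φ.1 x ∘ₗ (S x).subtype, fun x i z hz => Φ.2 x i z hz⟩, ?_⟩
  ext x y a z
  have h1 : Φ.1 y (v x y a z) - w x y a (Φ.1 x z) = η x y a (p x z) :=
    LinearMap.congr_fun (congrFun (congrFun (congrFun hΦ x) y) a) z
  have h2 : p x z = z := LinearMap.congr_fun (hp x) z
  rw [h2] at h1
  exact h1

theorem eul_nonneg_of_surjective {v : HQ V V} {w : HQ W W}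
    (h : Function.Surjective (delta F G v w)) : 0 ≤ eul F G := by
  have := LinearMap.finrank_le_finrank_of_surjective h
  rw [eul]
  omega

theorem eul_nonneg_of_qSub (h : genericExt F G = 0) {S : ∀ x, Submodule ℂ (V x)} (hS : QSub F S) :
    0 ≤ eul (fun x => (F x).sub (S x)) G := by
  obtain ⟨v, w, hvw⟩ := (genericExt_eq_zero_iff F G).1 h
  obtain ⟨N, hN, hs⟩ := hS v
  have h1 : 0 ≤ subEul F G fun x => (N x).1 :=
    eul_nonneg_of_surjective (hs.surjective_delta_restrict hvw)
  exact h1.trans (subEul_le_of_position_le F G (position_le_of_mem_schubertVariety F hN)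
    fun x => (N x).2)

theorem surjective_delta_of_equiv {V' : Q₀ → Type*} [∀ x, AddCommGroup (V' x)]
    [∀ x, Module ℂ (V' x)] {F' : ∀ x, Filtration (V' x)} (e : ∀ x, V x ≃ₗ[ℂ] V' x)
    (he : ∀ x i, ∀ z ∈ F' x i, (e x).symm z ∈ F x i) {v : HQ V V} {w : HQ W W}
    (h : Function.Surjective (delta F G v w)) :
    Function.Surjective (delta F' G (fun x y a => (e y).toLinearMap ∘ₗ v x y a ∘ₗ
      (e x).symm.toLinearMap) w) := by
  intro η
  obtain ⟨ψ, hψ⟩ := h fun x y a => η x y a ∘ₗ (e x).toLinearMap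
  refine ⟨⟨fun x => ψ.1 x ∘ₗ (e x).symm.toLinearMap, fun x i z hz => ψ.2 x i _ (he x i z hz)⟩, ?_⟩
  ext x y a z
  have h1 := LinearMap.congr_fun (congrFun (congrFun (congrFun hψ x) y) a) ((e x).symm z)
  rw [delta_apply] at h1
  simpa [delta, commMap] using h1

/-- Whether the filtered `Ext` with a given `w` vanishes for some representation on a family of
subspaces depends only on the position of that family. -/
theorem exists_surjective_delta_of_position_eq {N S : ∀ x, Submodule ℂ (V x)}
    (h : position F N = position F S) {w : HQ W W}
    (hS : ∃ s, Function.Surjective (delta (fun x => (F x).sub (S x)) G s w)) :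
    ∃ s, Function.Surjective (delta (fun x => (F x).sub (N x)) G s w) := by
  choose π hπ hπF using fun x => (F x).exists_retraction (S x)
  obtain ⟨n, hn, rfl⟩ := exists_nilFam_of_position_eq hπ hπF h
  obtain ⟨s, hs⟩ := hS
  have hnn := fun x => nilHom_apply_apply (mem_nilFam.1 hn x)
  refine ⟨_, surjective_delta_of_equiv
    (fun x => (unipotent (n x) (hnn x)).submoduleMap (S x)) (fun x i z hz => ?_) hs⟩
  obtain ⟨z, s, hs, rfl⟩ := z
  have h1 : ((unipotent (n x) (hnn x)).submoduleMap (S x)).symm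
      ⟨(LinearMap.id + n x : V x →ₗ[ℂ] V x) s, s, hs, rfl⟩ = ⟨s, hs⟩ := by
    rw [LinearEquiv.symm_apply_eq]
    rfl
  change (((unipotent (n x) (hnn x)).submoduleMap (S x)).symm
      ⟨(LinearMap.id + n x : V x →ₗ[ℂ] V x) s, s, hs, rfl⟩ : S x) ∈ (F x).sub (S x) i
  rw [h1]
  change s ∈ F x i
  have h2 : s + n x s ∈ F x i := hz
  have h3 := Submodule.sub_mem _ h2 ((mem_nilFam.1 hn x).1 i _ h2)
  simpa [hnn] using h3

theorem exists_comp_eq_of_ker_le {A B C : Type*} [AddCommGroup A] [Module ℂ A] [AddCommGroup B]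
    [Module ℂ B] [AddCommGroup C] [Module ℂ C] (φ : A →ₗ[ℂ] B) (η : A →ₗ[ℂ] C)
    (h : LinearMap.ker φ ≤ LinearMap.ker η) : ∃ ω : B →ₗ[ℂ] C, ω ∘ₗ φ = η := by
  obtain ⟨ω, hω⟩ := LinearMap.exists_extend
    ((LinearMap.ker φ).liftQ η h ∘ₗ φ.quotKerEquivRange.symm.toLinearMap)
  refine ⟨ω, LinearMap.ext fun z => ?_⟩
  have h1 := LinearMap.congr_fun hω (φ.quotKerEquivRange (Submodule.Quotient.mk z))
  simpa using h1

/-- If `w` maximizes the rank of `δ_{v,w}`, then `Ext` does not drop on passing to the kernel of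
an element of the kernel of `δ_{v,w}`. -/
theorem surjective_delta_of_ker {v : HQ V V} {w : HQ W W}
    (hmax : ∀ w', finrank ℂ (LinearMap.range (deltaLinear F G (v, w')))
      ≤ finrank ℂ (LinearMap.range (deltaLinear F G (v, w))))
    {φ : gQFil F G} (hφ : delta F G v w φ = 0)
    (hS : IsSubrep v fun x => LinearMap.ker (φ.1 x))
    (h : Function.Surjective
      (delta (fun x => (F x).sub (LinearMap.ker (φ.1 x))) G hS.restrict w)) :
    Function.Surjective (delta F G v w) := by
  intro η
  obtain ⟨ψ, hψ⟩ := h fun x y a => η x y a ∘ₗ (LinearMap.ker (φ.1 x)).subtype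
  obtain ⟨Ψ, hΨ⟩ := exists_gQFil_extension _ ψ
  -- After correcting by an extension of ψ, the error η - δ(Ψ) vanishes on ker φ, so it factors as
  -- ωφ.
  have hker : ∀ x y (a : x ⟶ y),
      LinearMap.ker (φ.1 x) ≤ LinearMap.ker ((η - delta F G v w Ψ) x y a) := by
    intro x y a z hz
    have h1 : ψ.1 y (hS.restrict x y a ⟨z, hz⟩) - w x y a (ψ.1 x ⟨z, hz⟩) = η x y a z :=
      LinearMap.congr_fun (congrFun (congrFun (congrFun hψ x) y) a) ⟨z, hz⟩
    rw [← hΨ, ← hΨ] at h1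
    rw [LinearMap.mem_ker]
    change η x y a z - (Ψ.1 y (v x y a z) - w x y a (Ψ.1 x z)) = 0
    rw [← h1]
    exact sub_self _
  choose ω hω using fun x y a => exists_comp_eq_of_ker_le _ _ (hker x y a)
  -- Deforming w in the direction ω cannot raise the rank, so the derivative of δ at the kernel
  -- element φ, which is -ωφ, stays in the range of δ. Hence the error is hit.
  have hmem : deltaLinear F G (0, ω) φ ∈ LinearMap.range (deltaLinear F G (v, w)) := by
    refine mem_range_of_finrank_range_le (fun t => ?_) hφ
    have h1 : deltaLinear F G (v, w) + t • deltaLinear F G (0, ω)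
        = deltaLinear F G (v, w + t • ω) := by
      rw [← map_smul, ← map_add]
      simp
    rw [h1]
    exact hmax _
  obtain ⟨Θ, hΘ⟩ := hmem
  have h2 : deltaLinear F G (0, ω) φ = -(η - delta F G v w Ψ) := by
    ext x y a z
    have h3 := LinearMap.congr_fun (hω x y a) z
    change φ.1 y (0 : V y) - ω x y a (φ.1 x z) = -((η - delta F G v w Ψ) x y a z)
    rw [← h3, map_zero, zero_sub]
    rfl
  refine ⟨Ψ - Θ, ?_⟩
  have h4 : delta F G v w Θ = -(η - delta F G v w Ψ) := hΘ.trans h2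
  rw [map_sub, h4]
  abel

end Main

/-! ### Subrepresentations with negative Euler number. -/

section Induction

variable {Q₀ : Type u₀} [Quiver.{u₁} Q₀] [Fintype Q₀] [∀ x y : Q₀, Finite (x ⟶ y)]
variable {W : Q₀ → Type u₃} [∀ x, AddCommGroup (W x)] [∀ x, Module ℂ (W x)]
  [∀ x, FiniteDimensional ℂ (W x)]

theorem IsSubrep.map_subtype {V : Q₀ → Type u₂} [∀ x, AddCommGroup (V x)] [∀ x, Module ℂ (V x)]
    {v : HQ V V} {S : ∀ x, Submodule ℂ (V x)} (hS : IsSubrep v S)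
    {N : ∀ x, Submodule ℂ (S x)} (hN : IsSubrep hS.restrict N) :
    IsSubrep v fun x => (N x).map (S x).subtype := by
  rintro x y a _ ⟨_, ⟨z, hz, rfl⟩, rfl⟩
  exact ⟨hS.restrict x y a z, hN.apply_mem a hz, rfl⟩

theorem lineOpen_surjective_delta {V : Q₀ → Type u₂} [∀ x, AddCommGroup (V x)]
    [∀ x, Module ℂ (V x)] [∀ x, FiniteDimensional ℂ (V x)] (F : ∀ x, Filtration (V x))
    (G : ∀ x, Filtration (W x)) :
    LineOpen {p : HQ V V × HQ W W | Function.Surjective (delta F G p.1 p.2)} := by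
  have := lineOpen_le_finrank_range (deltaLinear F G) (finrank ℂ (HQ V W))
  convert this using 3 with p
  exact surjective_delta_iff

/-- If the generic filtered `Ext` does not vanish, every representation has a subrepresentation
with negative Euler number. -/
theorem exists_subEul_neg (G : ∀ x, Filtration (W x)) (V : Q₀ → Type u₂)
    [∀ x, AddCommGroup (V x)] [∀ x, Module ℂ (V x)] [∀ x, FiniteDimensional ℂ (V x)]
    (F : ∀ x, Filtration (V x)) (hns : ∀ v w, ¬ Function.Surjective (delta F G v w))
    (v₀ : HQ V V) : ∃ N, IsSubrep v₀ N ∧ subEul F G N < 0 := by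
  classical
  induction hn : ∑ x, finrank ℂ (V x) using Nat.strong_induction_on generalizing V with
  | _ n ih =>
  obtain ⟨L, hL⟩ := Filtration.exists_common_top F
  obtain ⟨p₀, hp₀⟩ : ∃ p₀, ∀ p, finrank ℂ (LinearMap.range (deltaLinear F G p))
      ≤ finrank ℂ (LinearMap.range (deltaLinear F G p₀)) := by
    have hb : BddAbove (Set.range fun p => finrank ℂ (LinearMap.range (deltaLinear F G p))) :=
      ⟨finrank ℂ (HQ V W), by rintro _ ⟨p, rfl⟩; exact Submodule.finrank_le _⟩
    obtain ⟨p₀, hp₀⟩ := Nat.sSup_mem (Set.range_nonempty _) hb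
    exact ⟨p₀, fun p => (le_csSup hb ⟨p, rfl⟩).trans_eq hp₀.symm⟩
  let U : Set (HQ V V × HQ W W) := {p | finrank ℂ (LinearMap.range (deltaLinear F G p₀))
      ≤ finrank ℂ (LinearMap.range (deltaLinear F G p))}
  have hU : LineOpen U := lineOpen_le_finrank_range _ _
  -- The kernel S met below depends on (v, w), yet w must be generic for S. This is possible in
  -- advance because `Z` depends only on the position of S, and there are finitely many positions.
  let Z (S : ∀ x, Submodule ℂ (V x)) : Set (HQ W W) :=
    {w | ∃ s, Function.Surjective (delta (fun x => (F x).sub (S x)) G s w)}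
  have hZ : ∀ S, LineOpen (Z S) := by
    intro S
    have h1 : Z S = ⋃ s, (fun w => (s, 0) + LinearMap.inr ℂ _ _ w) ⁻¹'
        {p : HQ (fun x => S x) (fun x => S x) × HQ W W |
          Function.Surjective (delta (fun x => (F x).sub (S x)) G p.1 p.2)} := by
      ext w
      simp [Z]
    rw [h1]
    exact LineOpen.iUnion fun s => (lineOpen_surjective_delta _ G).preimage _ _
  have : Finite (Set.range (position F)) := (finite_range_position F).to_subtype
  let B (τ : Set.range (position F)) : Set (HQ V V × HQ W W) :=
    {p | ∀ S, position F S = τ → (Z S).Nonempty → p.2 ∈ Z S}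
  have hB : ∀ τ, LineOpen (B τ) ∧ (B τ).Nonempty := by
    intro τ
    by_cases h : ∃ S, position F S = τ ∧ (Z S).Nonempty
    · obtain ⟨S, hS, hSZ⟩ := h
      have h1 : B τ = (fun p : HQ V V × HQ W W => 0 + LinearMap.snd ℂ _ _ p) ⁻¹' Z S := by
        ext p
        simp only [B, Set.mem_ofPred_eq, Set.mem_preimage, zero_add, LinearMap.snd_apply]
        exact ⟨fun h => h S hS hSZ, fun h S' hS' _ =>
          exists_surjective_delta_of_position_eq (hS'.trans hS.symm) h⟩
      rw [h1]
      refine ⟨(hZ S).preimage _ _, ?_⟩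
      obtain ⟨w, hw⟩ := hSZ
      exact ⟨(0, w), by simpa using hw⟩
    · push Not at h
      have h1 : B τ = Set.univ := by
        ext p
        simp only [B, Set.mem_ofPred_eq, Set.mem_univ, iff_true]
        intro S hS hSZ
        exact absurd hSZ (by simpa [Set.not_nonempty_iff_eq_empty] using h S hS)
      rw [h1]
      exact ⟨fun _ _ _ => by simp, Set.univ_nonempty⟩
  have hA : LineOpen (U ∩ ⋂ τ, B τ) := hU.inter (LineOpen.iInter fun τ => (hB τ).1)
  obtain ⟨p₁, hp₁⟩ := hU.nonempty_inter (LineOpen.iInter fun τ => (hB τ).1) ⟨p₀, le_refl (finrank ℂ (LinearMap.range (deltaLinear F G p₀)))⟩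
    (LineOpen.nonempty_biInter (fun τ => (hB τ).1) fun τ => (hB τ).2)
  have hgen : ∀ v w, (v, w) ∈ U ∩ ⋂ τ, B τ → ∃ N, IsSubrep v N ∧ subEul F G N < 0 := by
    rintro v w ⟨hvU, hvB⟩
    by_cases hinj : LinearMap.ker (delta F G v w) = ⊥
    · refine ⟨fun _ => ⊤, fun x y a => le_top, ?_⟩
      rw [subEul_top, eul]
      have h1 := LinearMap.finrank_range_of_inj (LinearMap.ker_eq_bot.1 hinj)
      have h2 : finrank ℂ (LinearMap.range (delta F G v w)) < finrank ℂ (HQ V W) :=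
        not_le.1 fun h => hns v w (surjective_delta_iff.2 h)
      omega
    · obtain ⟨φ, hφ, hφ0⟩ := Submodule.exists_mem_ne_zero_of_ne_bot hinj
      rw [LinearMap.mem_ker] at hφ
      have hφv : ∀ x y (a : x ⟶ y) z, φ.1 y (v x y a z) = w x y a (φ.1 x z) := fun x y a z =>
        sub_eq_zero.1 (LinearMap.congr_fun (congrFun (congrFun (congrFun hφ x) y) a) z)
      let S : ∀ x, Submodule ℂ (V x) := fun x => LinearMap.ker (φ.1 x)
      have hS : IsSubrep v S := by
        rintro x y a _ ⟨z, hz, rfl⟩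
        change φ.1 y (v x y a z) = 0
        rw [hφv, show φ.1 x z = 0 from hz, map_zero]
      have hbad : ∀ s w, ¬ Function.Surjective (delta (fun x => (F x).sub (S x)) G s w) := by
        intro s₁ w₁ hs₁
        -- If some w₁ works for ker φ, the generic w works as well, with some representation s' on
        -- ker φ.
        obtain ⟨s', hs'⟩ := Set.mem_iInter.1 hvB ⟨_, S, rfl⟩ S rfl ⟨w₁, s₁, hs₁⟩
        choose π hπ hπF using fun x => (F x).exists_retraction (S x)
        -- Moving v along u changes its restriction to S linearly from the given one to s'. As u has
        -- image in S = ker φ, the element φ stays in the kernel of δ for every t.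
        let u : HQ V V := fun x y a => (S y).subtype ∘ₗ (s' x y a - hS.restrict x y a) ∘ₗ π x
        have hu : ∀ (t : ℂ), IsSubrep (v + t • u) S := fun t =>
          (stabilizing S).add_mem hS ((stabilizing S).smul_mem t (by
            rintro x y a _ ⟨z, hz, rfl⟩
            exact ((s' x y a - hS.restrict x y a) (π x z)).2))
        have hres : ∀ t, (hu t).restrict = hS.restrict + t • (s' - hS.restrict) := by
          intro t
          ext x y a z
          change (v x y a z : V y) + t • ((s' x y a - hS.restrict x y a) (π x z) : V y)
            = v x y a z + t • ((s' x y a - hS.restrict x y a) z : V y)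
          rw [hπ]
        have h1 : LineOpen {t : ℂ | (v + t • u, w) ∈ U} := by
          convert hU.preimage (v, w) (LinearMap.toSpanSingleton ℂ _ (u, (0 : HQ W W))) using 1
          ext t
          simp
        have h2 : LineOpen {t : ℂ | Function.Surjective
            (delta (fun x => (F x).sub (S x)) G (hu t).restrict w)} := by
          convert (lineOpen_surjective_delta (fun x => (F x).sub (S x)) G).preimage
            (hS.restrict, w) (LinearMap.toSpanSingleton ℂ _ (s' - hS.restrict, (0 : HQ W W)))
            using 1
          ext t
          simp [hres]
        -- Maximal rank holds near t = 0 and surjectivity on S near t = 1, each off finitely many t,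
        -- so both hold at a common t.
        obtain ⟨t, ht1, ht2⟩ := h1.nonempty_inter h2 ⟨0, by simpa using hvU⟩
          ⟨1, by simpa [hres] using hs'⟩
        refine hns _ w (surjective_delta_of_ker (fun w' => (hp₀ _).trans ht1) (φ := φ) ?_ (hu t) ht2)
        ext x y a z
        change φ.1 y (v x y a z + t • ((s' x y a - hS.restrict x y a) (π x z) : V y))
          - w x y a (φ.1 x z) = 0
        have h3 : φ.1 y ((s' x y a - hS.restrict x y a) (π x z) : V y) = 0 :=
          ((s' x y a - hS.restrict x y a) (π x z)).2
        rw [map_add, map_smul, h3, smul_zero, add_zero, hφv, sub_self]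
      have hlt : ∑ x, finrank ℂ (S x) < n := by
        rw [← hn]
        have : ∃ x, φ.1 x ≠ 0 := by
          by_contra! h
          exact hφ0 (Subtype.ext (funext h))
        obtain ⟨x, hx⟩ := this
        refine Finset.sum_lt_sum (fun x _ => Submodule.finrank_le _) ⟨x, Finset.mem_univ x, ?_⟩
        exact Submodule.finrank_lt fun h => hx (LinearMap.ker_eq_top.1 h)
      obtain ⟨N, hN, hN'⟩ := ih _ hlt (fun x => S x) (fun x => (F x).sub (S x)) hbad hS.restrict rfl
      exact ⟨_, hS.map_subtype hN, by rwa [subEul_map_subtype]⟩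
  -- Passage from generic pairs to v₀ itself: limits of subrepresentations have larger positions,
  -- hence still negative Euler number.
  have hfreq := (hA.eventually hp₁ (v₀, p₁.2)).frequently
  obtain ⟨S, N, hneg, hN, hd, hpos⟩ := exists_isSubrep_position_le F (fun d => eulOf G L d < 0) v₀
    (p₁.1 - v₀) (hfreq.mono fun t ht => by
      obtain ⟨N, hN, hN'⟩ := hgen _ _ ht
      exact ⟨N, hN, by rwa [subEul_eq_eulOf F G hL] at hN'⟩)
  refine ⟨N, hN, (subEul_le_of_position_le F G hpos hd).trans_lt ?_⟩
  rwa [subEul_eq_eulOf F G hL]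

end Induction

end FilteredQuiver

namespace FilteredQuiver

open Module Filter Topology

set_option linter.unusedSectionVars false

universe u₀ u₁ u₂ u₃

/-! ### Canonical minimal subrepresentations and their generic position. -/

section Converse

variable {Q₀ : Type u₀} [Quiver.{u₁} Q₀] [Fintype Q₀] [∀ x y : Q₀, Finite (x ⟶ y)]
variable {V : Q₀ → Type u₂} [∀ x, AddCommGroup (V x)] [∀ x, Module ℂ (V x)]
  [∀ x, FiniteDimensional ℂ (V x)]
variable {W : Q₀ → Type u₃} [∀ x, AddCommGroup (W x)] [∀ x, Module ℂ (W x)]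
  [∀ x, FiniteDimensional ℂ (W x)]
variable (F : ∀ x, Filtration (V x)) (G : ∀ x, Filtration (W x))

/-- A perturbation of the Euler number of a family of subspaces by its dimension; its minimizer
among the subrepresentations of a given representation is unique. -/
noncomputable def perturbedEul (N : ∀ x, Submodule ℂ (V x)) : ℤ :=
  (∑ x, finrank ℂ (V x) + 1 : ℕ) * subEul F G N + ∑ x, (finrank ℂ (N x) : ℤ)

theorem perturbedEul_eq_of_position_eq {N N' : ∀ x, Submodule ℂ (V x)}
    (h : position F N = position F N') : perturbedEul F G N = perturbedEul F G N' := by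
  obtain ⟨L, hL⟩ := Filtration.exists_common_top F
  rw [perturbedEul, perturbedEul, subEul_eq_eulOf F G hL, subEul_eq_eulOf F G hL, h]
  simp only [finrank_eq_of_position_eq F h]

/-- `N` minimizes `perturbedEul` among the subrepresentations of `v`. -/
def IsMinimalSubrep (v : HQ V V) (N : ∀ x, Submodule ℂ (V x)) : Prop :=
  IsSubrep v N ∧ ∀ N', IsSubrep v N' → perturbedEul F G N ≤ perturbedEul F G N'

theorem exists_isMinimalSubrep (v : HQ V V) : ∃ N, IsMinimalSubrep F G v N := by
  obtain ⟨m, ⟨N, hN, rfl⟩, hm⟩ := Int.exists_least_of_bdd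
    (P := fun m => ∃ N, IsSubrep v N ∧ perturbedEul F G N = m)
    ⟨(∑ x, finrank ℂ (V x) + 1 : ℕ) * -(finrank ℂ (HQ V W) : ℤ), by
      rintro _ ⟨N, -, rfl⟩
      have h1 := mul_le_mul_of_nonneg_left (le_subEul F G N)
        (Int.natCast_nonneg (∑ x, finrank ℂ (V x) + 1))
      have h2 : 0 ≤ ∑ x, (finrank ℂ (N x) : ℤ) :=
        Finset.sum_nonneg fun x _ => Int.natCast_nonneg _
      rw [perturbedEul]
      linarith⟩
    ⟨_, fun _ => ⊤, fun x y a => le_top, rfl⟩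
  exact ⟨N, hN, fun N' hN' => hm _ ⟨N', hN', rfl⟩⟩

variable {F G}

/-- Submodularity makes N ∩ N' a minimizer as well. Its Euler number differs from that of N by a
multiple of 1/K of a dimension difference smaller than K, so both differences vanish and N ∩ N' = N.
-/
theorem IsMinimalSubrep.le {v : HQ V V} {N N' : ∀ x, Submodule ℂ (V x)}
    (h : IsMinimalSubrep F G v N) (h' : IsMinimalSubrep F G v N') : N ≤ N' := by
  have hm := h.2 N' h'.1
  have hinf := h.2 _ (h.1.inf h'.1)
  have hsup := h'.2 _ (h.1.sup h'.1)
  have hsub := mul_le_mul_of_nonneg_left (subEul_sup_add_inf_le F G N N')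
    (Int.natCast_nonneg (∑ x, finrank ℂ (V x) + 1))
  have hdim : ∑ x, (finrank ℂ ((N ⊔ N') x) : ℤ) + ∑ x, (finrank ℂ ((N ⊓ N') x) : ℤ)
      = ∑ x, (finrank ℂ (N x) : ℤ) + ∑ x, (finrank ℂ (N' x) : ℤ) := by
    rw [← Finset.sum_add_distrib, ← Finset.sum_add_distrib]
    refine Finset.sum_congr rfl fun x _ => ?_
    exact_mod_cast Submodule.finrank_sup_add_finrank_inf_eq (N x) (N' x)
  have hle : ∀ x, finrank ℂ ((N ⊓ N') x) ≤ finrank ℂ (N x) := fun x =>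
    Submodule.finrank_mono inf_le_left
  have hleV : ∑ x, (finrank ℂ (N x) : ℤ) ≤ ∑ x, (finrank ℂ (V x) : ℤ) :=
    Finset.sum_le_sum fun x _ => by exact_mod_cast Submodule.finrank_le _
  have h0 : 0 ≤ ∑ x, (finrank ℂ ((N ⊓ N') x) : ℤ) :=
    Finset.sum_nonneg fun x _ => Int.natCast_nonneg _
  have hle' : ∑ x, (finrank ℂ ((N ⊓ N') x) : ℤ) ≤ ∑ x, (finrank ℂ (N x) : ℤ) :=
    Finset.sum_le_sum fun x _ => by exact_mod_cast hle x
  simp only [perturbedEul] at hm hinf hsup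
  push_cast at hm hinf hsup hsub
  set K : ℤ := ∑ x, (finrank ℂ (V x) : ℤ) + 1 with hK
  have heq : K * (subEul F G (N ⊓ N') - subEul F G N)
      = ∑ x, (finrank ℂ (N x) : ℤ) - ∑ x, (finrank ℂ ((N ⊓ N') x) : ℤ) := by
    linarith
  have hz : subEul F G (N ⊓ N') - subEul F G N = 0 := by
    have hKpos : 0 < K := by linarith
    have h1 : 0 ≤ subEul F G (N ⊓ N') - subEul F G N := by
      by_contra! hneg
      have := mul_neg_of_pos_of_neg hKpos hneg
      linarith
    have h2 : subEul F G (N ⊓ N') - subEul F G N < 1 := by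
      by_contra! hge
      have := mul_le_mul_of_nonneg_left hge hKpos.le
      linarith
    omega
  rw [hz, mul_zero] at heq
  have hall := (Finset.sum_eq_sum_iff_of_le (s := Finset.univ)
    (f := fun x => (finrank ℂ ((N ⊓ N') x) : ℤ)) (g := fun x => (finrank ℂ (N x) : ℤ))
    fun x _ => by exact_mod_cast hle x).1 (by linarith)
  intro x
  have h3 : finrank ℂ (N x ⊓ N' x : Submodule ℂ (V x)) = finrank ℂ (N x) := by
    exact_mod_cast hall x (Finset.mem_univ x)
  rw [← Submodule.eq_of_le_of_finrank_eq inf_le_left h3]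
  exact inf_le_right

theorem IsMinimalSubrep.unique {v : HQ V V} {N N' : ∀ x, Submodule ℂ (V x)}
    (h : IsMinimalSubrep F G v N) (h' : IsMinimalSubrep F G v N') : N = N' :=
  le_antisymm (h.le h') (h'.le h)

/-- Negative means at most -1, so the perturbed value of N' is at most -K + dim V = -1, whereas
eul(N) ≥ 0 would make that of N nonnegative. -/
theorem IsMinimalSubrep.subEul_neg {v : HQ V V} {N N' : ∀ x, Submodule ℂ (V x)}
    (h : IsMinimalSubrep F G v N) (hN' : IsSubrep v N') (hneg : subEul F G N' < 0) :
    subEul F G N < 0 := by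
  have h1 := h.2 N' hN'
  have h2 : ∑ x, (finrank ℂ (N' x) : ℤ) ≤ ∑ x, (finrank ℂ (V x) : ℤ) :=
    Finset.sum_le_sum fun x _ => by exact_mod_cast Submodule.finrank_le _
  have h3 : 0 ≤ ∑ x, (finrank ℂ (N x) : ℤ) := Finset.sum_nonneg fun x _ => Int.natCast_nonneg _
  have h4 : 0 ≤ ∑ x, (finrank ℂ (V x) : ℤ) := Finset.sum_nonneg fun x _ => Int.natCast_nonneg _
  simp only [perturbedEul] at h1
  push_cast at h1
  by_contra! hge
  have h5 : 0 ≤ (∑ x, (finrank ℂ (V x) : ℤ) + 1) * subEul F G N := by positivity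
  have h6 := mul_le_mul_of_nonneg_left (show subEul F G N' ≤ -1 by omega)
    (show 0 ≤ ∑ x, (finrank ℂ (V x) : ℤ) + 1 by omega)
  linarith

theorem position_map_unipotent {S : ∀ x, Submodule ℂ (V x)} {π : ∀ x, V x →ₗ[ℂ] S x}
    {n : ∀ x, V x →ₗ[ℂ] V x} (hn : n ∈ nilFam F π) :
    position F (fun x => (S x).map (LinearMap.id + n x)) = position F S := by
  have h1 : ∀ x, finrank ℂ ((S x).map (LinearMap.id + n x)) = finrank ℂ (S x) := fun x =>
    LinearEquiv.finrank_map_eq (unipotent (n x) (nilHom_apply_apply (mem_nilFam.1 hn x))) _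
  exact position_eq_of_mem_schubertCell
    (N := fun x => ⟨(S x).map (LinearMap.id + n x), h1 x⟩)
    ⟨_, unipotent_mem_borel hn, fun x => rfl⟩

/-- A family in the position of the minimal subrepresentations of generic representations. -/
theorem exists_qSub_isMinimalSubrep (F : ∀ x, Filtration (V x)) (G : ∀ x, Filtration (W x)) :
    ∃ S v N, QSub F S ∧ eul (fun x => (F x).sub (S x)) (fun x => (F x).quot (S x)) = 0 ∧
      IsMinimalSubrep F G v N ∧ position F N = position F S := by
  choose Nst hNst using exists_isMinimalSubrep F G
  have : Finite (Set.range (position F)) := (finite_range_position F).to_subtype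
  choose S hSτ using fun τ : Set.range (position F) => τ.2
  choose π hπ hπF using fun τ x => (F x).exists_retraction (S τ x)
  obtain ⟨τ, ⟨v, hv⟩, hdim, a, ha, ha0, haP⟩ := exists_dominant_of_cover
    (D := fun τ => nilFam F (π τ) × stabilizing (S τ))
    (fun τ p => transport p.1.1 p.2.1) (fun τ => isPolyMap_transport)
    (fun τ => {v | position F (Nst v) = τ}) (fun v => ⟨⟨_, Nst v, rfl⟩, rfl⟩) (by
      intro τ v hv
      have hv' : position F (Nst v) = position F (S τ) := Eq.trans hv (hSτ τ).symm
      obtain ⟨n, hn, hN⟩ := exists_nilFam_of_position_eq (hπ τ) (hπF τ) hv'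
      have hback : transport n (transport (-n) v) = v := by
        have := transport_neg_transport (Submodule.neg_mem _ hn) v
        rwa [neg_neg] at this
      refine ⟨⟨⟨n, hn⟩, ⟨transport (-n) v, ?_⟩⟩, hback, ?_⟩
      · refine (isSubrep_transport hn).1 ?_
        rw [hback, ← hN]
        exact (hNst v).1
      · rintro ⟨⟨n', hn'⟩, ⟨v', hv'S⟩⟩ h
        simp only at h
        subst h
        -- Any point of the fibre gives a subrepresentation in the same position as the minimal one,
        -- hence with the same perturbed value; uniqueness of the minimizer then fixes n', and with
        -- it v'.
        have h1 : IsMinimalSubrep F G (transport n' v')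
            (fun x => (S τ x).map (LinearMap.id + n' x)) := by
          refine ⟨(isSubrep_transport hn').2 hv'S, fun N' hN' => ?_⟩
          rw [perturbedEul_eq_of_position_eq F G ((position_map_unipotent hn').trans hv'.symm)]
          exact (hNst _).2 N' hN'
        have h2 := h1.unique (hNst _)
        have h3 : n' = n := by
          funext x
          refine nilHom_eq_of_map_eq (hπ τ x) (mem_nilFam.1 hn' x) (mem_nilFam.1 hn x) ?_
          exact (congrFun h2 x).trans (congrFun hN x)
        subst h3
        simp only [transport_neg_transport hn])
  have hpos : position F (Nst v) = position F (S τ) := Eq.trans hv (hSτ τ).symm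
  refine ⟨S τ, v, Nst v, ?_, ?_, hNst v, hpos⟩
  -- Off the zeros of the polynomial a, each representation preserves a point of the cell itself;
  -- the closed Schubert variety takes care of the rest.
  · refine exists_isSubrep_of_lineOpen isClosed_closure (A := {v | a v ≠ 0}) (fun v hv u => ?_) ha0
      fun v hv => ?_
    · simpa using ha.finite_zeros_line hv u
    · obtain ⟨⟨⟨n, hn⟩, ⟨v', hv'⟩⟩, rfl⟩ := haP v hv
      refine ⟨fun x => ⟨(S τ x).map (LinearMap.id + n x),
        finrank_eq_of_position_eq F (position_map_unipotent hn) x⟩, subset_closure ?_,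
        (isSubrep_transport hn).2 hv'⟩
      exact mem_schubertCell_of_position_eq (position_map_unipotent hn)
  -- The parameter space has dimension dim H(V) + eul(S, V/S) and also dim H(V).
  · rw [Module.finrank_prod, finrank_nilFam (hπ τ) (hπF τ)] at hdim
    have h1 := finrank_stabilizing (S := S τ)
    rw [eul]
    omega

end Converse

end FilteredQuiver

theorem mainTheorem5
    {Q₀ : Type*} [Quiver Q₀] [Finite Q₀] [∀ x y : Q₀, Finite (x ⟶ y)]
    (hQ : FilteredQuiver.IsAcyclic Q₀)
    (V : Q₀ → Type*) [∀ x, AddCommGroup (V x)] [∀ x, Module ℂ (V x)]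
    [∀ x, FiniteDimensional ℂ (V x)]
    (W : Q₀ → Type*) [∀ x, AddCommGroup (W x)] [∀ x, Module ℂ (W x)]
    [∀ x, FiniteDimensional ℂ (W x)]
    (F : ∀ x, FilteredQuiver.Filtration (V x)) (G : ∀ x, FilteredQuiver.Filtration (W x)) :
    (FilteredQuiver.genericExt F G = 0 →
      ∀ S : ∀ x, Submodule ℂ (V x), FilteredQuiver.QSub F S →
        0 ≤ FilteredQuiver.eul (fun x => (F x).sub (S x)) G) ∧
    ((∀ S : ∀ x, Submodule ℂ (V x), FilteredQuiver.QSub F S →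
        FilteredQuiver.eul (fun x => (F x).sub (S x)) (fun x => (F x).quot (S x)) = 0 →
        0 ≤ FilteredQuiver.eul (fun x => (F x).sub (S x)) G) →
      FilteredQuiver.genericExt F G = 0) := by
  cases nonempty_fintype Q₀
  refine ⟨fun h S hS => FilteredQuiver.eul_nonneg_of_qSub h hS, fun h => ?_⟩
  by_contra hext
  rw [FilteredQuiver.genericExt_eq_zero_iff] at hext
  push Not at hext
  obtain ⟨S, v, N, hS, hS0, hN, hNS⟩ := FilteredQuiver.exists_qSub_isMinimalSubrep F G
  obtain ⟨N', hN', hneg⟩ := FilteredQuiver.exists_subEul_neg G V F hext v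
  have h1 : FilteredQuiver.subEul F G N < 0 := hN.subEul_neg hN' hneg
  have h2 : FilteredQuiver.subEul F G S ≤ FilteredQuiver.subEul F G N :=
    FilteredQuiver.subEul_le_of_position_le F G (fun x i => by rw [hNS])
      fun x => (FilteredQuiver.finrank_eq_of_position_eq F hNS x).symm
  exact absurd (h S hS hS0) (not_le.2 (h2.trans_lt h1))
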